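/- **Setting.** An sc-Banach space is a Banach space $E=E_0$ with a nested sequence of Banach spaces $E_0\supseteq E_1\supseteq\cdots$ such that the inclusions $E_n\to E_m$ ($m<n$) are compact and $E_\infty=\bigcap_m E_m$ is dense in every $E_m$; $E^1$ denotes $E_1$ with $(E^1)_m=E_{m+1}$. For $U$ relatively open in a partial quadrant of $E$ put $U_m=U\cap E_m$; a map $f:U\to F$ is $\mathrm{sc}^0$ if it induces continuous maps $U_m\to F_m$ for all $m$; it is $\mathrm{sc}^1$ if it is $\mathrm{sc}^0$, for every $x\in U_1$ there is $Df(x)\in\mathcal L(E_0,F_0)$ with $\|f(x+h)-f(x)-Df(x)h\|_0/\|h\|_1\to0$ as $\|h\|_1\to 0$ ($x+h\in U_1$), and $Tf:TU=U^1\oplus E\to TF=F^1\oplus F$, $Tf(x,h)=(f(x),Df(x)h)$, is $\mathrm{sc}^0$; it is $\mathrm{sc}^{k+1}$ if it is $\mathrm{sc}^1$ and $Tf$ is $\mathrm{sc}^k$, and sc-smooth if it is $\mathrm{sc}^k$ for all $k$. An sc-smooth splicing $\mathcal S=(\pi,E,V)$ consists of a relatively open subset $V$ of a partial quadrant in an sc-Banach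 space $W$ and bounded projections $\pi_v$ of $E$ ($v\in V$) such that $(v,e)\mapsto\pi_v(e)$ is sc-smooth; its core is $K^{\mathcal S}=\{(v,e)\in V\oplus E\mid\pi_v(e)=e\}$. For $O$ open in $K^{\mathcal S}$ put $\widehat O=\{(v,e)\in V\oplus E\mid(v,\pi_v(e))\in O\}$; a map $g$ on $O$ is sc-smooth if $(v,e)\mapsto g(v,\pi_v(e))$ is sc-smooth on $\widehat O$. A general splicing $(\rho,F,(O,\mathcal S))$ consists of bounded projections $\rho_w$ of an sc-Banach space $F$ ($w\in O$) with $(w,u)\mapsto\rho_w(u)$ sc-smooth on $O\oplus F$ (that is, $(v,e,u)\mapsto\rho_{(v,\pi_v(e))}(u)$ is sc-smooth on $\widehat O\oplus F$); its core is $\{(w,u)\in O\oplus F\mid\rho_w(u)=u\}$, and sc-smoothness of maps on open subsets of it is defined likewise, by precomposition with $(v,e,u)\mapsto(v,\pi_v(e),\rho_{(v,\pi_v(e))}(u))$. It is a strong bundle splicing $\mathcal R$ if, moreover, $\rho$ restricts to $F^1$ and $(\rho,F^1,(O,\mathcal S))$ is a general splicing, too; its core is $K^{\mathcal R}$, and $K^{\mathcal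 R}(0)$, $K^{\mathcal R}(1)$ denote the cores of the splicings with fibres $F$ and $F^1$. A map $(w,u)\mapsto(\varphi(w),\Phi(w,u))$ between (open parts, over open subsets of the bases, of) such cores is $\mathrm{sc}_\triangleleft$-smooth if it induces sc-smooth maps $K^{\mathcal R}(i)\to K^{\mathcal R'}(i)$ for $i=0,1$. An M-polyfold (of type 0, resp. of type 1) is a second countable Hausdorff space with a maximal atlas of sc-smoothly compatible charts onto open subsets of cores of sc-smooth splicings (resp. of general splicings); sc-smooth maps between M-polyfolds are defined by charts. A strong M-polyfold bundle over the M-polyfold $X$ (of type 0) is a surjective sc-smooth map $p:Z\to X$, where $Z$ is an M-polyfold of type 1 and every fibre carries a Banach space structure (inducing its topology as a subspace of $Z$), together with a maximal atlas of strong bundle charts $(U,\Phi,(K^{\mathcal R},\mathcal R))$ whose transition maps are $\mathrm{sc}_\triangleleft$-smooth. Here $\Phi:p^{-1}(U)\to K^{\mathcal R}$ is a chart of $Z$ that is linear on the fibres and covers a chart $\varphi:U\to O$ of $X$, $\mathcal R=(\rho,F,(O,\mathcal S))$ is a strong bundle splicing, and the sets $U$ cover $X$. **Proposition.** Let $p:Z\to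 X$ be a strong M-polyfold bundle and let $f:Y\to X$ be an sc-smooth map between M-polyfolds. Let $f^*Z=\{(y,z)\in Y\times Z\mid p(z)=f(y)\}$, with the subspace topology of $Y\times Z$, and let $p'(y,z)=y$ and $f'(y,z)=z$. Then $p':f^*Z\to Y$ carries one and only one structure of a strong M-polyfold bundle over the M-polyfold $Y$ with the following two properties: 1. $f'$ is linear from the fibre over $y$ to the fibre $p^{-1}(f(y))$, for every $y\in Y$; 2. for every strong bundle chart $(U,\Phi,(K^{\mathcal R},\mathcal R))$ of $Z$ in its atlas, with $\mathcal R=(\rho,F,(O,\mathcal S))$ and covering $\varphi$, and every M-polyfold chart $\psi:U'\to O'\subset K^{\mathcal S'}$ of $Y$ with $f(U')\subset U$, the formula $\rho'(w,u)=\rho(\varphi\circ f\circ\psi^{-1}(w),u)$ defines a strong bundle splicing $\mathcal R'=(\rho',F,(O',\mathcal S'))$, and the atlas contains the strong bundle chart $\Psi:p'^{-1}(U')\to K^{\mathcal R'}$, $\Psi(y,z)=(\psi(y),\mathrm{pr}_2\Phi(z))$, which covers $\psi$. For this structure, $f':f^*Z\to Z$ is an $\mathrm{sc}_\triangleleft$-smooth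 strong bundle map over $f$. -/

import Mathlib

open Set Filter Topology

universe u v w x

/-! ### Sc-Banach spaces -/

/-- A Banach space with an sc-structure: a nested sequence `E₀ ⊇ E₁ ⊇ ⋯` of Banach spaces, given
with the (injective, compact) inclusions `E_{m+1} → E_m`, such that `E_∞` is dense in every `E_m`.
The underlying Banach space is `lvl 0`. A point of `E_∞` is a compatible sequence of points. -/
structure ScBanach : Type (u + 1) where
  lvl : ℕ → Type u
  [normed : ∀ m, NormedAddCommGroup (lvl m)]
  [space : ∀ m, NormedSpace ℝ (lvl m)]
  [complete : ∀ m, CompleteSpace (lvl m)]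
  incl : ∀ m, lvl (m + 1) →L[ℝ] lvl m
  incl_injective : ∀ m, Function.Injective (incl m)
  incl_compact : ∀ m, IsCompactOperator (incl m)
  dense_smooth : ∀ m, Dense {a : lvl m | ∃ s : ∀ n, lvl n,
    (∀ n, incl n (s (n + 1)) = s n) ∧ s m = a}

attribute [instance] ScBanach.normed ScBanach.space ScBanach.complete

namespace ScBanach

/-- The inclusion `E_m → E_0`. -/
def emb (E : ScBanach.{u}) : ∀ m, E.lvl m →L[ℝ] E.lvl 0
  | 0 => ContinuousLinearMap.id ℝ (E.lvl 0)
  | m + 1 => (E.emb m).comp (E.incl m)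

/-- `E¹`: the space `E₁` with the sc-structure `(E¹)_m = E_{m+1}`. -/
abbrev shift (E : ScBanach.{u}) : ScBanach.{u} where
  lvl m := E.lvl (m + 1)
  incl m := E.incl (m + 1)
  incl_injective m := E.incl_injective (m + 1)
  incl_compact m := E.incl_compact (m + 1)
  dense_smooth m := by
    refine (E.dense_smooth (m + 1)).mono ?_
    rintro a ⟨s, hs, rfl⟩
    exact ⟨fun n => s (n + 1), fun n => hs (n + 1), rfl⟩

/-- `E ⊕ F` with the sc-structure `(E ⊕ F)_m = E_m ⊕ F_m`. -/
noncomputable abbrev prod (E : ScBanach.{u}) (F : ScBanach.{v}) : ScBanach.{max u v} where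
  lvl m := E.lvl m × F.lvl m
  incl m := (E.incl m).prodMap (F.incl m)
  incl_injective m := (E.incl_injective m).prodMap (F.incl_injective m)
  incl_compact m := by
    obtain ⟨K, hK, hK'⟩ := E.incl_compact m
    obtain ⟨L, hL, hL'⟩ := F.incl_compact m
    exact ⟨K ×ˢ L, hK.prod hL, prod_mem_nhds hK' hL'⟩
  dense_smooth m := by
    refine ((E.dense_smooth m).prod (F.dense_smooth m)).mono ?_
    rintro ⟨a, b⟩ ⟨⟨s, hs, rfl⟩, ⟨t, ht, rfl⟩⟩
    exact ⟨fun n => (s n, t n), fun n => Prod.ext (hs n) (ht n), rfl⟩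

/-- `ℝⁿ` with its constant sc-structure. -/
noncomputable abbrev real (n : ℕ) : ScBanach.{0} where
  lvl _ := Fin n → ℝ
  incl _ := ContinuousLinearMap.id ℝ (Fin n → ℝ)
  incl_injective _ := Function.injective_id
  incl_compact _ := ⟨Metric.closedBall 0 1, isCompact_closedBall 0 1,
    Metric.closedBall_mem_nhds 0 one_pos⟩
  dense_smooth m := by
    refine dense_univ.mono ?_
    intro a _
    exact ⟨fun _ => a, fun _ => rfl, rfl⟩

/-- The sc-Banach space `TE = E¹ ⊕ E`, with `(TE)_m = E_{m+1} ⊕ E_m`. -/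
noncomputable abbrev tangent (E : ScBanach.{u}) : ScBanach.{u} := E.shift.prod E

end ScBanach

/-! ### Sc-calculus -/

/-- `U_m = U ∩ E_m`, as a subset of `E_m`. -/
def scLevel (E : ScBanach.{u}) (U : Set (E.lvl 0)) (m : ℕ) : Set (E.lvl m) :=
  {a | E.emb m a ∈ U}

/-- `TU = U¹ ⊕ E`, as a subset of `TE`. -/
def scTangentSet (E : ScBanach.{u}) (U : Set (E.lvl 0)) : Set (E.tangent.lvl 0) :=
  {a | E.incl 0 a.1 ∈ U}

/-- `f : U → F` is of class sc⁰: it induces continuous maps `U_m → F_m` on all levels. -/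
def IsSc0 (E : ScBanach.{u}) (F : ScBanach.{v}) (U : Set (E.lvl 0))
    (f : E.lvl 0 → F.lvl 0) : Prop :=
  ∀ m, ∃ g : E.lvl m → F.lvl m, ContinuousOn g (scLevel E U m) ∧
    ∀ a ∈ scLevel E U m, F.emb m (g a) = f (E.emb m a)

/-- `f : U → F` is of class sc^k. For `k + 1`: `f` is sc⁰; with `f₁ : U₁ → F₁` the map induced on
level one, at every `a ∈ U₁` there is `Df(a) ∈ L(E₀, F₀)` with
`‖f(a+h) - f(a) - Df(a)h‖₀ / ‖h‖₁ → 0` as `‖h‖₁ → 0`, `a + h ∈ U₁`; and the tangent map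
`Tf(a, h) = (f(a), Df(a)h)` is of class sc^k on `TU`. Only the values of `f` on `U` matter. -/
def IsScDiff : ℕ → ∀ (E : ScBanach.{u}) (F : ScBanach.{v}) (_ : Set (E.lvl 0))
    (_ : E.lvl 0 → F.lvl 0), Prop
  | 0, E, F, U, f => IsSc0 E F U f
  | k + 1, E, F, U, f => IsSc0 E F U f ∧
      ∃ (f₁ : E.lvl 1 → F.lvl 1) (Df : E.lvl 1 → E.lvl 0 →L[ℝ] F.lvl 0),
        (∀ a ∈ scLevel E U 1, F.incl 0 (f₁ a) = f (E.incl 0 a)) ∧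
        (∀ a ∈ scLevel E U 1, HasFDerivWithinAt (fun b => f (E.incl 0 b))
          ((Df a).comp (E.incl 0)) (scLevel E U 1) a) ∧
        IsScDiff k E.tangent F.tangent (scTangentSet E U) (fun a => (f₁ a.1, Df a.1 a.2))

/-- Sc-smoothness of `f : U → F`. -/
def IsScSmooth (E : ScBanach.{u}) (F : ScBanach.{v}) (U : Set (E.lvl 0))
    (f : E.lvl 0 → F.lvl 0) : Prop :=
  ∀ k, IsScDiff k E F U f

/-- A bounded operator that induces bounded operators on all levels. -/
def IsScOperator (E : ScBanach.{u}) (F : ScBanach.{v}) (T : E.lvl 0 →L[ℝ] F.lvl 0) : Prop :=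
  ∀ m, ∃ Tm : E.lvl m →L[ℝ] F.lvl m, ∀ a, F.emb m (Tm a) = T (E.emb m a)

/-- Partial quadrants: `C ⊆ W` corresponds to `[0,∞)ⁿ ⊕ Q` under a linear sc-isomorphism
`W ≅ ℝⁿ ⊕ Q`. -/
def IsPartialQuadrant (W : ScBanach.{u}) (C : Set (W.lvl 0)) : Prop :=
  ∃ (n : ℕ) (Q : ScBanach.{u}) (T : W.lvl 0 ≃L[ℝ] ((ScBanach.real n).prod Q).lvl 0),
    IsScOperator W ((ScBanach.real n).prod Q) T.toContinuousLinearMap ∧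
    IsScOperator ((ScBanach.real n).prod Q) W T.symm.toContinuousLinearMap ∧
    T '' C = {a | ∀ i, 0 ≤ a.1 i}

/-- `A` is an open subset of `B`, in the relative topology. -/
def IsOpenIn {T : Type u} [TopologicalSpace T] (A B : Set T) : Prop :=
  ∃ G : Set T, IsOpen G ∧ A = G ∩ B

/-! ### Splicings and local models -/

/-- The data through which the smooth structure of a splicing core is used: an sc-Banach space, the
subset `dom` of it over which the splicing is defined, and the retraction `ret` of `dom` onto the
core that the splicing defines. It is used only for the splicings below. -/
structure ScModel : Type (u + 1) where
  space : ScBanach.{u}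
  dom : Set (space.lvl 0)
  ret : space.lvl 0 → space.lvl 0

/-- The splicing core. -/
def ScModel.core (M : ScModel.{u}) : Set (M.space.lvl 0) := {a | a ∈ M.dom ∧ M.ret a = a}

/-- For an open subset `A` of a splicing core, the set `Â` of points that are retracted to `A`. -/
def ScModel.hat (M : ScModel.{u}) (A : Set (M.space.lvl 0)) : Set (M.space.lvl 0) :=
  {a | a ∈ M.dom ∧ M.ret a ∈ A}

/-- Sc-smoothness of a map `g`, defined on an open subset `A` of a splicing core, into another
splicing core: the map `ĝ = g ∘ ret` on `Â` is sc-smooth. -/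
def IsScSmoothBetween (M N : ScModel.{u}) (A : Set (M.space.lvl 0))
    (g : M.space.lvl 0 → N.space.lvl 0) : Prop :=
  IsScSmooth M.space N.space (M.hat A) (fun a => g (M.ret a))

/-- An sc-smooth splicing `S = (π, E, V)`, with `V` open in a partial quadrant `C ⊆ W`. -/
structure ScSplicing : Type (u + 1) where
  W : ScBanach.{u}
  E : ScBanach.{u}
  C : Set (W.lvl 0)
  V : Set (W.lvl 0)
  quadrant : IsPartialQuadrant W C
  isOpenIn : IsOpenIn V C
  π : W.lvl 0 → E.lvl 0 →L[ℝ] E.lvl 0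
  idem : ∀ a ∈ V, ∀ e, π a (π a e) = π a e
  smooth : IsScSmooth (W.prod E) E {a | a.1 ∈ V} (fun a => π a.1 a.2)

/-- The splicing core `K^S = {(v, e) ∈ V ⊕ E | π_v(e) = e}` with `ret (v, e) = (v, π_v(e))`. -/
noncomputable abbrev ScSplicing.model (S : ScSplicing.{u}) : ScModel.{u} where
  space := S.W.prod S.E
  dom := {a | a.1 ∈ S.V}
  ret a := (a.1, S.π a.1 a.2)

/-- A local M-polyfold model `(O, S)`: an open subset `O` of the splicing core `K^S`. -/
structure LocalModel : Type (u + 1) where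
  S : ScSplicing.{u}
  O : Set (S.model.space.lvl 0)
  isOpenIn : IsOpenIn O S.model.core

/-- The sc-Banach space `W ⊕ E` that contains `O`. -/
noncomputable abbrev LocalModel.space (L : LocalModel.{u}) : ScBanach.{u} := L.S.model.space

/-- A general sc-smooth splicing `(ρ, F, (O, S))`; sc-smoothness of `ρ` means that
`(v, e, u) ↦ ρ_{(v, π_v(e))}(u)` is sc-smooth on `Ô ⊕ F`. -/
structure GeneralSplicing (L : LocalModel.{u}) (F : ScBanach.{u}) : Type u where
  ρ : L.space.lvl 0 → F.lvl 0 →L[ℝ] F.lvl 0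
  idem : ∀ a ∈ L.O, ∀ e, ρ a (ρ a e) = ρ a e
  smooth : IsScSmooth (L.space.prod F) F {a | a.1 ∈ L.S.model.hat L.O}
    (fun a => ρ (L.S.model.ret a.1) a.2)

/-- The splicing core `{(w, u) ∈ O ⊕ F | ρ_w(u) = u}` of a general splicing, with
`ret (v, e, u) = (v, π_v(e), ρ_{(v, π_v(e))}(u))`. -/
noncomputable abbrev GeneralSplicing.model {L : LocalModel.{u}} {F : ScBanach.{u}} (R : GeneralSplicing L F) :
    ScModel.{u} where
  space := L.space.prod F
  dom := {a | a.1 ∈ L.S.model.hat L.O}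
  ret a := (L.S.model.ret a.1, R.ρ (L.S.model.ret a.1) a.2)

/-- A strong bundle splicing `R = (ρ, F, (O, S))`: `R⁰ = (ρ, F, (O, S))` is a general splicing, and
`ρ` restricts to `F¹` so that `R¹ = (ρ, F¹, (O, S))` is a general splicing, too. (That `ρ` maps
`O_m ⊕ F_{m+1}` to `F_{m+1}` is contained in the sc-smoothness of `R¹`.) -/
structure StrongSplicing (L : LocalModel.{u}) (F : ScBanach.{u}) : Type u where
  zero : GeneralSplicing L F
  one : GeneralSplicing L F.shift
  restricts : ∀ a ∈ L.O, ∀ e : F.lvl 1, F.incl 0 (one.ρ a e) = zero.ρ a (F.incl 0 e)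

/-- Sc_◁-smoothness of a strong bundle map `g : K^R | A → K^{R'}`, for `A` open in `O`: it has the
form `g(w, u) = (φ(w), Φ(w, u))` and induces sc-smooth maps `K^R(i) → K^{R'}(i)` over `A` for
`i = 0` and `i = 1`. Here `K^R(1)` is the core of `R¹`. -/
def IsScStrongSmooth {L L' : LocalModel.{u}} {F F' : ScBanach.{u}}
    (R : StrongSplicing L F) (R' : StrongSplicing L' F') (A : Set (L.space.lvl 0))
    (g : L.space.lvl 0 × F.lvl 0 → L'.space.lvl 0 × F'.lvl 0) : Prop :=
  (∃ φ : L.space.lvl 0 → L'.space.lvl 0, ∀ a ∈ R.zero.model.core, a.1 ∈ A → (g a).1 = φ a.1) ∧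
  IsScSmoothBetween R.zero.model R'.zero.model {a | a ∈ R.zero.model.core ∧ a.1 ∈ A} g ∧
  ∃ g₁ : L.space.lvl 0 × F.lvl 1 → L'.space.lvl 0 × F'.lvl 1,
    (∀ a ∈ R.one.model.core, a.1 ∈ A →
      g (a.1, F.incl 0 a.2) = ((g₁ a).1, F'.incl 0 (g₁ a).2)) ∧
    IsScSmoothBetween R.one.model R'.one.model {a | a ∈ R.one.model.core ∧ a.1 ∈ A} g₁

/-! ### M-polyfolds -/

/-- A chart: a homeomorphism of an open subset of `X` onto an open subset of a splicing core. -/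
structure ScChart (X : Type v) [TopologicalSpace X] (M : ScModel.{u}) extends
    PartialEquiv X (M.space.lvl 0) where
  open_source : IsOpen source
  target_open : IsOpenIn target M.core
  continuousOn_toFun : ContinuousOn toFun source
  continuousOn_invFun : ContinuousOn invFun target

/-- The transition map from `c` to `d` is sc-smooth. -/
def ScChart.TransitionSmooth {X : Type v} [TopologicalSpace X] {M N : ScModel.{u}}
    (c : ScChart X M) (d : ScChart X N) : Prop :=
  IsScSmoothBetween M N {a | a ∈ c.target ∧ c.toPartialEquiv.symm a ∈ d.source}
    (fun a => d.toPartialEquiv (c.toPartialEquiv.symm a))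

/-- Sc-smooth compatibility of charts. -/
def ScChart.Compatible {X : Type v} [TopologicalSpace X] {M N : ScModel.{u}}
    (c : ScChart X M) (d : ScChart X N) : Prop :=
  c.TransitionSmooth d ∧ d.TransitionSmooth c

/-- A second countable Hausdorff space `X` with a maximal atlas of sc-smoothly compatible charts
into the cores of a given class `(M i)` of splicings. -/
structure ScAtlas {ι : Type w} (M : ι → ScModel.{u}) (X : Type v) [TopologicalSpace X] where
  t2 : T2Space X
  secondCountable : SecondCountableTopology X
  atlas : ∀ i, Set (ScChart X (M i))
  cover : ∀ a : X, ∃ i, ∃ c ∈ atlas i, a ∈ c.source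
  compatible : ∀ i, ∀ c ∈ atlas i, ∀ j, ∀ d ∈ atlas j, c.Compatible d
  maximal : ∀ i, ∀ c : ScChart X (M i),
    (∀ j, ∀ d ∈ atlas j, c.Compatible d) → c ∈ atlas i

/-- An M-polyfold structure (of type 0) on `X`. -/
abbrev MPolyfold (X : Type v) [TopologicalSpace X] := ScAtlas ScSplicing.model.{u} X

/-- A splicing of type 1: a general splicing together with its local model and its fibre. -/
structure TypeOneSplicing : Type (u + 1) where
  L : LocalModel.{u}
  F : ScBanach.{u}
  R : GeneralSplicing L F

noncomputable abbrev TypeOneSplicing.model (T : TypeOneSplicing.{u}) : ScModel.{u} := T.R.model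

/-- An M-polyfold structure of type 1 on `X`. -/
abbrev MPolyfoldOne (X : Type v) [TopologicalSpace X] := ScAtlas TypeOneSplicing.model.{u} X

/-- Sc-smooth maps between M-polyfolds (of the same or of different types). -/
def IsScSmoothMap {ι : Type w} {κ : Type x} {M : ι → ScModel.{u}} {N : κ → ScModel.{u}}
    {X : Type*} {Y : Type*} [TopologicalSpace X] [TopologicalSpace Y]
    (𝒳 : ScAtlas M X) (𝒴 : ScAtlas N Y) (f : X → Y) : Prop :=
  ∀ a : X, ∃ i, ∃ c ∈ 𝒳.atlas i, ∃ j, ∃ d ∈ 𝒴.atlas j,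
    a ∈ c.source ∧ MapsTo f c.source d.source ∧
    IsScSmoothBetween (M i) (N j) c.target
      (fun b => d.toPartialEquiv (f (c.toPartialEquiv.symm b)))

/-- The local M-polyfold model on which a chart takes its values. -/
abbrev ScChart.localModel {X : Type v} [TopologicalSpace X] {S : ScSplicing.{u}}
    (c : ScChart X S.model) : LocalModel.{u} := ⟨S, c.target, c.target_open⟩

/-! ### Strong M-polyfold bundles -/

/-- A strong bundle chart for `p : Z → X`, except for its fibrewise linearity and its compatibility
with the structures of `X` and `Z`: a homeomorphism `Φ = total` of `p⁻¹(U)` onto `K^R` that covers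
a homeomorphism `φ = base` of the open set `U` onto `O`. -/
structure StrongBundleChart {X : Type v} {Z : Type w} [TopologicalSpace X] [TopologicalSpace Z]
    (p : Z → X) {L : LocalModel.{u}} {F : ScBanach.{u}} (R : StrongSplicing L F) where
  base : ScChart X L.S.model
  base_target : base.target = L.O
  total : ScChart Z R.zero.model
  total_source : total.source = p ⁻¹' base.source
  total_target : total.target = R.zero.model.core
  covers : ∀ z ∈ total.source, (total.toPartialEquiv z).1 = base.toPartialEquiv (p z)

section

variable {X : Type v} {Z : Type w} [TopologicalSpace X] [TopologicalSpace Z] {p : Z → X}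
  {L L' : LocalModel.{u}} {F F' : ScBanach.{u}} {R : StrongSplicing L F} {R' : StrongSplicing L' F'}

/-- The chart is linear on the fibres of `p`. -/
def StrongBundleChart.FiberLinear [∀ a, AddCommGroup (p ⁻¹' {a})] [∀ a, Module ℝ (p ⁻¹' {a})]
    (c : StrongBundleChart p R) : Prop :=
  ∀ a ∈ c.base.source,
    (∀ z z' : p ⁻¹' {a}, (c.total.toPartialEquiv (z + z' : p ⁻¹' {a})).2 =
      (c.total.toPartialEquiv z).2 + (c.total.toPartialEquiv z').2) ∧
    (∀ (t : ℝ) (z : p ⁻¹' {a}), (c.total.toPartialEquiv (t • z : p ⁻¹' {a})).2 =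
      t • (c.total.toPartialEquiv z).2)

/-- The transition map `Ψ ∘ Φ⁻¹` over `φ(U ∩ U')` is an sc_◁-smooth strong bundle map. -/
def StrongBundleChart.TransitionSmooth (c : StrongBundleChart p R) (d : StrongBundleChart p R') :
    Prop :=
  IsScStrongSmooth R R'
    {a | a ∈ c.base.target ∧ c.base.toPartialEquiv.symm a ∈ d.base.source}
    (fun a => d.total.toPartialEquiv (c.total.toPartialEquiv.symm a))

/-- Sc_◁-compatibility of strong bundle charts. -/
def StrongBundleChart.Compatible (c : StrongBundleChart p R) (d : StrongBundleChart p R') : Prop :=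
  c.TransitionSmooth d ∧ d.TransitionSmooth c

end

/-- The structure of a strong M-polyfold bundle on `p : Z → X`, over the M-polyfold `X`: a type-1
M-polyfold structure on `Z` for which `p` is a surjective sc-smooth map, the structure of a Banach
space on every fibre (with the topology that it has as a subspace of `Z`), and a maximal atlas of
strong bundle charts that are linear on the fibres, smoothly compatible with the structures of `X`
and `Z`, and sc_◁-compatible with each other. -/
structure StrongBundle {X : Type v} {Z : Type w} [TopologicalSpace X] [TopologicalSpace Z]
    (𝒳 : MPolyfold.{u} X) (p : Z → X) where
  total : MPolyfoldOne.{u} Z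
  surjective : Function.Surjective p
  smooth : IsScSmoothMap total 𝒳 p
  [fiberGroup : ∀ a, AddCommGroup (p ⁻¹' {a})]
  [fiberModule : ∀ a, Module ℝ (p ⁻¹' {a})]
  fiberBanach : ∀ a, ∃ (B : Type w) (_ : NormedAddCommGroup B) (_ : NormedSpace ℝ B)
    (_ : CompleteSpace B), Nonempty ((p ⁻¹' {a}) ≃L[ℝ] B)
  atlas : ∀ {L : LocalModel.{u}} {F : ScBanach.{u}} (R : StrongSplicing L F),
    Set (StrongBundleChart p R)
  base_mem : ∀ {L : LocalModel.{u}} {F : ScBanach.{u}} (R : StrongSplicing L F), ∀ c ∈ atlas R,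
    c.base ∈ 𝒳.atlas L.S
  total_mem : ∀ {L : LocalModel.{u}} {F : ScBanach.{u}} (R : StrongSplicing L F), ∀ c ∈ atlas R,
    c.total ∈ total.atlas ⟨L, F, R.zero⟩
  linear : ∀ {L : LocalModel.{u}} {F : ScBanach.{u}} (R : StrongSplicing L F), ∀ c ∈ atlas R,
    c.FiberLinear
  cover : ∀ a : X, ∃ (L : LocalModel.{u}) (F : ScBanach.{u}) (R : StrongSplicing L F),
    ∃ c ∈ atlas R, a ∈ c.base.source
  compatible : ∀ {L L' : LocalModel.{u}} {F F' : ScBanach.{u}} (R : StrongSplicing L F)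
    (R' : StrongSplicing L' F'), ∀ c ∈ atlas R, ∀ d ∈ atlas R', c.Compatible d
  maximal : ∀ {L : LocalModel.{u}} {F : ScBanach.{u}} (R : StrongSplicing L F)
    (c : StrongBundleChart p R), c.base ∈ 𝒳.atlas L.S → c.total ∈ total.atlas ⟨L, F, R.zero⟩ →
    c.FiberLinear →
    (∀ {L' : LocalModel.{u}} {F' : ScBanach.{u}} (R' : StrongSplicing L' F'), ∀ d ∈ atlas R',
      c.Compatible d) → c ∈ atlas R

/-- `g : Z → Z'` is an sc_◁-smooth strong bundle map over `f : X → X'`, expressed in charts. -/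
def IsStrongBundleMap {X X' Z Z' : Type*} [TopologicalSpace X] [TopologicalSpace X']
    [TopologicalSpace Z] [TopologicalSpace Z'] {𝒳 : MPolyfold.{u} X} {𝒳' : MPolyfold.{u} X'}
    {p : Z → X} {p' : Z' → X'} (𝒵 : StrongBundle 𝒳 p) (𝒵' : StrongBundle 𝒳' p')
    (g : Z → Z') (f : X → X') : Prop :=
  (∀ z, p' (g z) = f (p z)) ∧
  ∀ a : X, ∃ (L : LocalModel.{u}) (F : ScBanach.{u}) (R : StrongSplicing L F)
    (L' : LocalModel.{u}) (F' : ScBanach.{u}) (R' : StrongSplicing L' F'),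
    ∃ c ∈ 𝒵.atlas R, ∃ d ∈ 𝒵'.atlas R',
      a ∈ c.base.source ∧ MapsTo f c.base.source d.base.source ∧
      IsScStrongSmooth R R' c.base.target
        (fun b => d.total.toPartialEquiv (g (c.total.toPartialEquiv.symm b)))

/-! ### The pullback -/

/-- The set `f^*Z = {(y, z) ∈ Y × Z | p(z) = f(y)}`, with the subspace topology of `Y × Z`. -/
abbrev PullbackTotal {X Y Z : Type*} (f : Y → X) (p : Z → X) := {q : Y × Z // p q.2 = f q.1}

/-- The projection `p' : f^*Z → Y`. -/
def pullbackProj {X Y Z : Type*} (f : Y → X) (p : Z → X) : PullbackTotal f p → Y := fun q => q.1.1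

/-- The projection `f' : f^*Z → Z`. -/
def pullbackLift {X Y Z : Type*} (f : Y → X) (p : Z → X) : PullbackTotal f p → Z := fun q => q.1.2

/-- The map that `f'` induces from the fibre of `f^*Z` over `y` to the fibre of `Z` over `f(y)`. -/
def pullbackFiberMap {X Y Z : Type*} (f : Y → X) (p : Z → X) (y : Y)
    (q : pullbackProj f p ⁻¹' {y}) : p ⁻¹' {f y} :=
  ⟨pullbackLift f p q.1, (q.1.2).trans (congrArg f q.2)⟩

/-- A strong bundle structure on `p' : f^*Z → Y` is induced by that of `Z`: the linear structure of
its fibres is the one for which `f'` is linear on the fibres; and for every strong bundle chart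
`(U, Φ, (K^R, R))` of `Z`, covering `φ`, and every chart `ψ : U' → O'` of `Y` with `f(U') ⊆ U`,
the atlas contains the chart `Ψ(y, z) = (ψ(y), pr₂ Φ(z))` over `U'`, covering `ψ`, with the
splicing `ρ'(w, u) = ρ(φ ∘ f ∘ ψ⁻¹(w), u)` on `O' ⊕ F`. -/
def IsInducedBundle {X Y Z : Type*} [TopologicalSpace X] [TopologicalSpace Y] [TopologicalSpace Z]
    {𝒳 : MPolyfold.{u} X} {𝒴 : MPolyfold.{u} Y} {p : Z → X} (𝒵 : StrongBundle 𝒳 p) (f : Y → X)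
    (𝒲 : StrongBundle 𝒴 (pullbackProj f p)) : Prop :=
  (∀ y,
    letI := 𝒲.fiberGroup y
    letI := 𝒲.fiberModule y
    letI := 𝒵.fiberGroup (f y)
    letI := 𝒵.fiberModule (f y)
    IsLinearMap ℝ (pullbackFiberMap f p y)) ∧
  ∀ {L : LocalModel.{u}} {F : ScBanach.{u}} (R : StrongSplicing L F), ∀ c ∈ 𝒵.atlas R,
    ∀ (S : ScSplicing.{u}), ∀ d ∈ 𝒴.atlas S, MapsTo f d.source c.base.source →
      ∃ R' : StrongSplicing d.localModel F,
        (∀ a ∈ d.target, ∀ e, R'.zero.ρ a e =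
          R.zero.ρ (c.base.toPartialEquiv (f (d.toPartialEquiv.symm a))) e) ∧
        ∃ k ∈ 𝒲.atlas R', k.base = d ∧
          ∀ q : PullbackTotal f p, q.1.1 ∈ d.source →
            k.total.toPartialEquiv q = (d.toPartialEquiv q.1.1, (c.total.toPartialEquiv q.1.2).2)

/-! In charts everything reduces to one substitution. Let θ = φ ∘ f ∘ ψ⁻¹ be the coordinate form of
f. It is sc-smooth with values in O, so ρ'(w, u) = ρ(θ(w), u) is again sc-smooth, with fibre F and
with fibre F¹ alike, and f' becomes (w, u) ↦ (θ(w), u). The transition between two pullback charts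
is the transition of Y on the base and, on the fibre, the fibre part of the transition of Z at
(θ(w), u); hence it is sc_◁-smooth (`StrongBundleChart.IsPullback.transitionSmooth`). Because f is
continuous, charts of Y can be shrunk until the pullback charts cover, and they generate the atlases
of f^*Z. The fibres get their linear structure through f', which is a homeomorphism on each fibre.

Uniqueness: f' is bijective on fibres, so its linearity determines the vector space structure. A
maximal atlas is determined by any covering family of its charts, and every induced structure
contains all pullback charts.

The analytic input is the chain rule for class sc^k (`IsScDiff.comp`) and locality of class sc^k
(`IsScDiff.of_locally`), which makes compatibility transitive through covering families. In the
chain rule, compactness of E₁ → E₀ makes up for the missing norm continuity of derivatives. Both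
results use regular domains (`IsScRegular`): local convexity for the mean value inequality, interior
points on every level for uniqueness of derivatives. -/

/-- Chain rule along a compact inclusion `i : E₁ → E₀`: the derivative of the outer map `γ` is only
assumed to be jointly continuous in the point and the vector, and the conclusion is
differentiability with respect to the norm of `E₁`. -/
theorem HasFDerivWithinAt.comp_of_isCompactOperator {E₁ E₀ F₁ F₀ G₀ : Type*}
    [NormedAddCommGroup E₁] [NormedSpace ℝ E₁] [NormedAddCommGroup E₀] [NormedSpace ℝ E₀]
    [NormedAddCommGroup F₁] [NormedSpace ℝ F₁] [NormedAddCommGroup F₀] [NormedSpace ℝ F₀]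
    [NormedAddCommGroup G₀] [NormedSpace ℝ G₀]
    {i : E₁ →L[ℝ] E₀} (hi : IsCompactOperator i) {j : F₁ →L[ℝ] F₀} {s : Set E₁} {t : Set F₁}
    {φ : E₁ → F₁} {a : E₁} (ha : a ∈ s) (hφc : ContinuousWithinAt φ s a) (hst : MapsTo φ s t)
    {A : E₀ →L[ℝ] F₀} (hφ : HasFDerivWithinAt (fun b => j (φ b)) (A.comp i) s a)
    {γ : F₁ → G₀} {B : F₁ → F₀ →L[ℝ] G₀}
    (hγ : ∀ b ∈ t, HasFDerivWithinAt γ ((B b).comp j) t b)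
    (hB : ContinuousOn (fun q : F₁ × F₀ => B q.1 q.2) (t ×ˢ univ))
    (ht : ∃ N ∈ 𝓝 (φ a), Convex ℝ (N ∩ t)) :
    HasFDerivWithinAt (fun b => γ (φ b)) (((B (φ a)).comp A).comp i) s a := by
  set y := φ a with hy
  set D := B y with hD
  have hyt : y ∈ t := hst ha
  -- The frozen operator `D` applied to `j ∘ φ` has a known derivative by `hφ`; after subtracting
  -- it, only a remainder of order o(‖b - a‖) has to be shown.
  suffices h : HasFDerivWithinAt (fun b => γ (φ b) - D (j (φ b))) (0 : E₁ →L[ℝ] G₀) s a by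
    have h2 : HasFDerivWithinAt (fun b => D (j (φ b))) (D.comp (A.comp i)) s a :=
      D.hasFDerivAt.comp_hasFDerivWithinAt a hφ
    have h3 := h.add h2
    simp only [zero_add] at h3
    refine HasFDerivWithinAt.congr_fderiv (h3.congr_of_eventuallyEq ?_ ?_) ?_
    · exact Eventually.of_forall fun b => by simp
    · simp
    · ext; simp
  set K := closure (i '' Metric.closedBall 0 1) with hK
  have hKc : IsCompact K := hi.isCompact_closure_image_closedBall (f := (i : E₁ →ₗ[ℝ] E₀)) 1
  have hAK : IsCompact (A '' K) := hKc.image A.continuous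
  refine HasFDerivWithinAt.of_isLittleO (Asymptotics.isLittleO_iff.2 fun ε hε => ?_)
  -- Joint continuity makes `B b k - D k` small near each `(y, k)`, and compactness of `A '' K`
  -- makes this uniform in `k`. This replaces norm continuity of `B`.
  have hev : ∀ᶠ q : F₁ × F₀ in 𝓝[t] y ×ˢ 𝓝ˢ (A '' K), ‖B q.1 q.2 - D q.2‖ < ε := by
    rw [hAK.prod_nhdsSet_eq_biSup]
    simp only [eventually_iSup]
    intro k _
    have hc : ContinuousWithinAt (fun q : F₁ × F₀ => B q.1 q.2 - D q.2) (t ×ˢ univ) (y, k) :=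
      (hB (y, k) ⟨hyt, mem_univ _⟩).sub
        ((D.continuous.comp continuous_snd).continuousWithinAt)
    have h0 : ‖B y k - D k‖ < ε := by simpa [hD] using hε
    have := hc.norm.eventually (gt_mem_nhds h0)
    rwa [nhdsWithin_prod_eq, nhdsWithin_univ] at this
  obtain ⟨u, hu, v, hv, huv⟩ := Filter.mem_prod_iff.1 hev
  obtain ⟨O, hO, hKO, hOv⟩ := mem_nhdsSet_iff_exists.1 hv
  obtain ⟨δ, hδ, hδO⟩ := hAK.exists_thickening_subset_open hO hKO
  obtain ⟨N, hN, hNc⟩ := ht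
  obtain ⟨r, hr, hru⟩ := Metric.mem_nhdsWithin_iff.1 hu
  have hconv : Convex ℝ (Metric.ball y r ∩ (N ∩ t)) := (convex_ball y r).inter hNc
  have h1 : ∀ᶠ b in 𝓝[s] a, φ b ∈ Metric.ball y r ∩ N :=
    hφc (Filter.inter_mem (Metric.ball_mem_nhds y hr) hN)
  have h2 := (Asymptotics.isLittleO_iff.1 hφ.isLittleO) (half_pos hδ)
  filter_upwards [h1, h2, self_mem_nhdsWithin] with b hb1 hb2 hbs
  by_cases hba : b = a
  · subst hba; simp
  have hpos : 0 < ‖b - a‖ := norm_pos_iff.2 (sub_ne_zero.2 hba)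
  set k := j (φ b - y) with hk
  -- The normalised increment of `j ∘ φ` is within δ/2 of the image under `A ∘ i` of a unit vector,
  -- which lies in `A '' K`.
  have hkK : ‖b - a‖⁻¹ • k ∈ v := by
    refine hOv (hδO (Metric.mem_thickening_iff.2
      ⟨A (i (‖b - a‖⁻¹ • (b - a))), mem_image_of_mem _
        (subset_closure (mem_image_of_mem _ ?_)), ?_⟩))
    · simp [norm_smul, hpos.ne']
    · have : ‖b - a‖⁻¹ • k - A (i (‖b - a‖⁻¹ • (b - a)))
          = ‖b - a‖⁻¹ • (j (φ b) - j y - (A.comp i) (b - a)) := by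
        simp [hk, smul_sub]
      rw [dist_eq_norm, this, norm_smul, norm_inv, norm_norm]
      calc ‖b - a‖⁻¹ * ‖j (φ b) - j y - (A.comp i) (b - a)‖
          ≤ ‖b - a‖⁻¹ * (δ / 2 * ‖b - a‖) := by gcongr
        _ = δ / 2 := by field_simp
        _ < δ := half_lt_self hδ
  have hbt : φ b ∈ Metric.ball y r ∩ (N ∩ t) := ⟨hb1.1, hb1.2, hst hbs⟩
  have hyy : y ∈ Metric.ball y r ∩ (N ∩ t) := ⟨Metric.mem_ball_self hr, mem_of_mem_nhds hN, hyt⟩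
  -- Mean value inequality along the segment from `y` to `φ b`, which local convexity keeps inside
  -- `t`. The increment of `φ` itself need not be O(‖b - a‖) in F₁; only its image `k` under `j`
  -- enters the derivative.
  set l : ℝ → F₁ := fun τ => y + τ • (φ b - y) with hl
  have hlm : MapsTo l (Icc 0 1) (Metric.ball y r ∩ (N ∩ t)) := fun τ hτ =>
    hconv.add_smul_sub_mem hyy hbt hτ
  have hld : ∀ τ ∈ Icc (0 : ℝ) 1, HasDerivWithinAt (fun τ => γ (l τ) - D (j (l τ)))
      (B (l τ) k - D k) (Icc 0 1) τ := by
    intro τ hτ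
    have hl' : HasDerivWithinAt l (φ b - y) (Icc 0 1) τ := by
      have := (((hasDerivAt_id τ).smul_const (φ b - y)).const_add y).hasDerivWithinAt (s := Icc 0 1)
      simpa [hl] using this
    have e1 := (hγ (l τ) (hlm hτ).2.2).comp_hasDerivWithinAt τ hl' (fun σ hσ => (hlm hσ).2.2)
    have e2 := (D.comp j).hasFDerivAt.comp_hasDerivWithinAt τ hl'
    exact e1.sub e2
  have hbd : ∀ τ ∈ Ico (0 : ℝ) 1, ‖B (l τ) k - D k‖ ≤ ε * ‖b - a‖ := by
    intro τ hτ
    have hm := hlm ⟨hτ.1, hτ.2.le⟩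
    have h3 : ‖B (l τ) (‖b - a‖⁻¹ • k) - D (‖b - a‖⁻¹ • k)‖ < ε :=
      huv (show (l τ, ‖b - a‖⁻¹ • k) ∈ u ×ˢ v from ⟨hru ⟨hm.1, hm.2.2⟩, hkK⟩)
    rw [map_smul, map_smul, ← smul_sub, norm_smul, norm_inv, norm_norm] at h3
    have := (inv_mul_lt_iff₀ hpos).1 h3
    linarith
  have := norm_image_sub_le_of_norm_deriv_le_segment_01' hld hbd
  simpa [hl, hy] using this

/-! ### Level inclusions and regular domains. -/

namespace ScBanach

theorem emb_injective (E : ScBanach.{u}) : ∀ m, Function.Injective (E.emb m)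
  | 0 => Function.injective_id
  | m + 1 => (E.emb_injective m).comp (E.incl_injective m)

theorem incl_emb_shift (E : ScBanach.{u}) :
    ∀ m (a : E.lvl (m + 1)), E.incl 0 (E.shift.emb m a) = E.emb (m + 1) a
  | 0, _ => rfl
  | m + 1, a => E.incl_emb_shift m (E.incl (m + 1) a)

theorem emb_prod (E : ScBanach.{u}) (F : ScBanach.{v}) :
    ∀ m (a : E.lvl m × F.lvl m), (E.prod F).emb m a = (E.emb m a.1, F.emb m a.2)
  | 0, _ => rfl
  | m + 1, a => E.emb_prod F m (E.incl m a.1, F.incl m a.2)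

theorem denseRange_incl (E : ScBanach.{u}) (m : ℕ) : DenseRange (E.incl m) := by
  refine (E.dense_smooth m).mono ?_
  rintro _ ⟨s, hs, rfl⟩
  exact ⟨s (m + 1), hs m⟩

end ScBanach

/-- A relatively open subset of a convex set that has interior points on every level. -/
def IsScRegular (E : ScBanach.{u}) (U : Set (E.lvl 0)) : Prop :=
  ∃ G C : Set (E.lvl 0), IsOpen G ∧ U = G ∩ C ∧ Convex ℝ C ∧
    ∀ m, (interior (scLevel E C m)).Nonempty

namespace IsScRegular

variable {E : ScBanach.{u}} {U : Set (E.lvl 0)}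

theorem univ : IsScRegular E univ :=
  ⟨Set.univ, Set.univ, isOpen_univ, by simp, convex_univ, fun m => by
    have : scLevel E Set.univ m = Set.univ := by simp [scLevel]
    simp [this]⟩

theorem inter_open (hU : IsScRegular E U) {G : Set (E.lvl 0)} (hG : IsOpen G) :
    IsScRegular E (G ∩ U) := by
  obtain ⟨G', C, hG', rfl, hC, hi⟩ := hU
  exact ⟨G ∩ G', C, hG.inter hG', (inter_assoc _ _ _).symm, hC, hi⟩

theorem prod (hU : IsScRegular E U) (F : ScBanach.{v}) :
    IsScRegular (E.prod F) {a | a.1 ∈ U} := by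
  obtain ⟨G, C, hG, rfl, hC, hi⟩ := hU
  refine ⟨{a | a.1 ∈ G}, {a | a.1 ∈ C}, hG.preimage continuous_fst, rfl,
    hC.linear_preimage (LinearMap.fst ℝ (E.lvl 0) (F.lvl 0)), fun m => ?_⟩
  have : scLevel (E.prod F) {a | a.1 ∈ C} m = scLevel E C m ×ˢ Set.univ := by
    ext a
    show ((E.prod F).emb m a).1 ∈ C ↔ a ∈ scLevel E C m ×ˢ Set.univ
    rw [ScBanach.emb_prod]
    simp [scLevel]
  rw [this, interior_prod_eq]
  exact (hi m).prod (by simp)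

theorem shift (hU : IsScRegular E U) : IsScRegular E.shift {a | E.incl 0 a ∈ U} := by
  obtain ⟨G, C, hG, rfl, hC, hi⟩ := hU
  refine ⟨{a | E.incl 0 a ∈ G}, {a | E.incl 0 a ∈ C}, hG.preimage (E.incl 0).continuous, rfl,
    hC.linear_preimage (E.incl 0).toLinearMap, fun m => ?_⟩
  have : scLevel E.shift {a | E.incl 0 a ∈ C} m = scLevel E C (m + 1) := by
    ext a
    show E.incl 0 (E.shift.emb m a) ∈ C ↔ E.emb (m + 1) a ∈ C
    rw [ScBanach.incl_emb_shift]
  rw [this]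
  exact hi (m + 1)

/-- This stability lets inductions on `k` pass from `U` to `TU`. -/
theorem tangent (hU : IsScRegular E U) : IsScRegular E.tangent (scTangentSet E U) :=
  hU.shift.prod E

theorem uniqueDiffOn (hU : IsScRegular E U) (m : ℕ) : UniqueDiffOn ℝ (scLevel E U m) := by
  obtain ⟨G, C, hG, rfl, hC, hi⟩ := hU
  have h : UniqueDiffOn ℝ (scLevel E C m) :=
    uniqueDiffOn_convex (hC.linear_preimage (E.emb m).toLinearMap) (hi m)
  have := h.inter (hG.preimage (E.emb m).continuous)
  rwa [inter_comm] at this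

theorem exists_convex_nhds (hU : IsScRegular E U) {m : ℕ} {a : E.lvl m} (ha : a ∈ scLevel E U m) :
    ∃ N ∈ 𝓝 a, Convex ℝ (N ∩ scLevel E U m) := by
  obtain ⟨G, C, hG, rfl, hC, -⟩ := hU
  obtain ⟨r, hr, hrG⟩ := Metric.isOpen_iff.1 (hG.preimage (E.emb m).continuous) a ha.1
  refine ⟨_, Metric.ball_mem_nhds a hr, ?_⟩
  have : Metric.ball a r ∩ scLevel E (G ∩ C) m = Metric.ball a r ∩ scLevel E C m := by
    ext b
    exact ⟨fun h => ⟨h.1, h.2.2⟩, fun h => ⟨h.1, hrG h.1, h.2⟩⟩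
  rw [this]
  exact (convex_ball a r).inter (hC.linear_preimage (E.emb m).toLinearMap)

end IsScRegular

theorem IsPartialQuadrant.isScRegular {W : ScBanach.{u}} {C : Set (W.lvl 0)}
    (hC : IsPartialQuadrant W C) : IsScRegular W C := by
  obtain ⟨n, Q, T, hT, hT', hTC⟩ := hC
  have hmem : ∀ a, a ∈ C ↔ ∀ i, 0 ≤ (T a).1 i := by
    intro a
    have : T a ∈ T '' C ↔ a ∈ C := T.injective.mem_set_image
    rw [← this, hTC]; rfl
  have hemb : ∀ m (a : Fin n → ℝ), (ScBanach.real n).emb m a = a := by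
    intro m
    induction m with
    | zero => intro a; rfl
    | succ m ih => intro a; exact ih a
  refine ⟨univ, C, isOpen_univ, by simp, ?_, fun m => ?_⟩
  · have h : Convex ℝ {a : (Fin n → ℝ) × Q.lvl 0 | ∀ i, 0 ≤ a.1 i} := by
      intro a ha b hb s t hs ht _ i
      have := add_nonneg (mul_nonneg hs (ha i)) (mul_nonneg ht (hb i))
      simpa using this
    have h2 : C = T.toLinearEquiv.toLinearMap ⁻¹' {a : (Fin n → ℝ) × Q.lvl 0 | ∀ i, 0 ≤ a.1 i} := by
      ext a; exact hmem a
    rw [h2]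
    exact h.linear_preimage _
  · obtain ⟨Tm, hTm⟩ := hT m
    obtain ⟨Sm, hSm⟩ := hT' m
    have hfst : ∀ a, (Tm a).1 = (T (W.emb m a)).1 := by
      intro a
      have := congrArg Prod.fst (hTm a)
      rw [ScBanach.emb_prod] at this
      rw [← hemb m (Tm a).1]
      exact this
    have hop : IsOpen {a : W.lvl m | ∀ i, 0 < (Tm a).1 i} := by
      simp only [ofPred_forall]
      refine isOpen_iInter_of_finite fun i => isOpen_lt continuous_const ?_
      exact (continuous_apply i).comp (continuous_fst.comp Tm.continuous)
    -- The point `((1, …, 1), 0)` is interior to the standard quadrant; the level-`m` operators of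
    -- the sc-isomorphism carry it, and the strict inequalities around it, to `W_m`.
    refine ⟨Sm ((fun _ => 1), 0), mem_interior.2 ⟨_, ?_, hop, ?_⟩⟩
    · intro a ha
      refine (hmem _).2 fun i => ?_
      rw [← hfst]
      exact (ha i).le
    · intro i
      have : T (W.emb m (Sm ((fun _ => 1), 0))) =
          ((ScBanach.real n).prod Q).emb m ((fun _ => 1), 0) := by
        rw [hSm]; simp
      rw [hfst, this, ScBanach.emb_prod, hemb]
      exact one_pos

theorem IsOpenIn.isScRegular {E : ScBanach.{u}} {A U : Set (E.lvl 0)} (h : IsOpenIn A U)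
    (hU : IsScRegular E U) : IsScRegular E A := by
  obtain ⟨G, hG, rfl⟩ := h
  exact hU.inter_open hG

/-! ### Calculus of maps of class sc^k. -/

section ScCalculus

variable {E : ScBanach.{u}} {F : ScBanach.{v}} {G : ScBanach.{w}} {U U' : Set (E.lvl 0)}
  {V : Set (F.lvl 0)}

theorem IsScDiff.isSc0 {k : ℕ} {f : E.lvl 0 → F.lvl 0} (hf : IsScDiff k E F U f) :
    IsSc0 E F U f := by
  cases k with
  | zero => exact hf
  | succ k => exact hf.1

theorem IsSc0.continuousOn {f : E.lvl 0 → F.lvl 0} (hf : IsSc0 E F U f) : ContinuousOn f U := by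
  obtain ⟨g, hg, h⟩ := hf 0
  exact hg.congr fun a ha => (h a ha).symm

/-- A map on level one that represents a map of class sc⁰ is continuous. -/
theorem IsSc0.continuousOn_one {f : E.lvl 0 → F.lvl 0} (hf : IsSc0 E F U f)
    {f₁ : E.lvl 1 → F.lvl 1} (h₁ : ∀ a ∈ scLevel E U 1, F.incl 0 (f₁ a) = f (E.incl 0 a)) :
    ContinuousOn f₁ (scLevel E U 1) := by
  obtain ⟨g, hg, h⟩ := hf 1
  exact hg.congr fun a ha => F.incl_injective 0 ((h₁ a ha).trans (h a ha).symm)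

theorem IsSc0.congr {f f' : E.lvl 0 → F.lvl 0} (hf : IsSc0 E F U f) (h : EqOn f' f U) :
    IsSc0 E F U f' := fun m => by
  obtain ⟨g, hg, hgf⟩ := hf m
  exact ⟨g, hg, fun a ha => (hgf a ha).trans (h ha).symm⟩

theorem IsSc0.mono {f : E.lvl 0 → F.lvl 0} (hf : IsSc0 E F U f) (h : U' ⊆ U) :
    IsSc0 E F U' f := fun m => by
  obtain ⟨g, hg, hgf⟩ := hf m
  exact ⟨g, hg.mono fun _ ha => h ha, fun a ha => hgf a (h ha)⟩

theorem IsSc0.comp {f : E.lvl 0 → F.lvl 0} {g : F.lvl 0 → G.lvl 0} (hg : IsSc0 F G V g)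
    (hf : IsSc0 E F U f) (h : MapsTo f U V) : IsSc0 E G U (g ∘ f) := fun m => by
  obtain ⟨f', hf', hff⟩ := hf m
  obtain ⟨g', hg', hgg⟩ := hg m
  have hm : MapsTo f' (scLevel E U m) (scLevel F V m) := fun a ha => by
    show F.emb m (f' a) ∈ V
    rw [hff a ha]; exact h ha
  exact ⟨g' ∘ f', hg'.comp hf' hm, fun a ha => by
    rw [Function.comp_apply, hgg _ (hm ha), hff a ha]; rfl⟩

/-- The tangent map is built from `f₁` and `Df`, which serve for `f'` unchanged; hence no induction
on `k`. -/
theorem IsScDiff.congr {k : ℕ} {f f' : E.lvl 0 → F.lvl 0} (hf : IsScDiff k E F U f)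
    (h : EqOn f' f U) : IsScDiff k E F U f' := by
  cases k with
  | zero => exact IsSc0.congr hf h
  | succ k =>
    obtain ⟨h0, f₁, Df, h1, hD, hT⟩ := hf
    exact ⟨h0.congr h, f₁, Df, fun a ha => (h1 a ha).trans (h ha).symm,
      fun a ha => (hD a ha).congr (fun b hb => h hb) (h ha), hT⟩

theorem IsScDiff.mono {k : ℕ} {E : ScBanach.{u}} {F : ScBanach.{v}} {U U' : Set (E.lvl 0)}
    {f : E.lvl 0 → F.lvl 0} (hf : IsScDiff k E F U f) (h : U' ⊆ U) : IsScDiff k E F U' f := by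
  induction k generalizing E F with
  | zero => exact IsSc0.mono hf h
  | succ k ih =>
    obtain ⟨h0, f₁, Df, h1, hD, hT⟩ := hf
    exact ⟨h0.mono h, f₁, Df, fun a ha => h1 a (h ha),
      fun a ha => (hD a (h ha)).mono fun b hb => h hb, ih hT fun a ha => h ha⟩

/-- The chain rule for maps of class sc^k. -/
theorem IsScDiff.comp {k : ℕ} {E : ScBanach.{u}} {F : ScBanach.{v}} {G : ScBanach.{w}}
    {U : Set (E.lvl 0)} {V : Set (F.lvl 0)} {f : E.lvl 0 → F.lvl 0} {g : F.lvl 0 → G.lvl 0}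
    (hV : IsScRegular F V) (hg : IsScDiff k F G V g) (hf : IsScDiff k E F U f)
    (h : MapsTo f U V) : IsScDiff k E G U (g ∘ f) := by
  induction k generalizing E F G with
  | zero => exact IsSc0.comp hg hf h
  | succ k ih =>
    obtain ⟨hf0, f₁, Df, hf1, hfD, hfT⟩ := hf
    obtain ⟨hg0, g₁, Dg, hg1, hgD, hgT⟩ := hg
    have hm : MapsTo f₁ (scLevel E U 1) (scLevel F V 1) := fun a ha => by
      show F.incl 0 (f₁ a) ∈ V
      rw [hf1 a ha]; exact h ha
    refine ⟨hg0.comp hf0 h, g₁ ∘ f₁, fun a => (Dg (f₁ a)).comp (Df a), fun a ha => ?_,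
      fun a ha => ?_, ?_⟩
    · rw [Function.comp_apply, hg1 _ (hm ha), hf1 a ha]; rfl
    · have hφ : HasFDerivWithinAt (fun b => F.incl 0 (f₁ b)) ((Df a).comp (E.incl 0))
          (scLevel E U 1) a := (hfD a ha).congr hf1 (hf1 a ha)
      -- Joint continuity of `(b, h) ↦ Dg(b)h` is level zero of the statement that `Tg` is sc⁰.
      have hB : ContinuousOn (fun q : F.lvl 1 × F.lvl 0 => Dg q.1 q.2)
          (scLevel F V 1 ×ˢ univ) := by
        have := continuous_snd.comp_continuousOn hgT.isSc0.continuousOn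
        exact this.mono fun q hq => hq.1
      exact (HasFDerivWithinAt.comp_of_isCompactOperator (E.incl_compact 0) ha
        (hf0.continuousOn_one hf1 a ha) hm hφ hgD hB (hV.exists_convex_nhds (hm ha))).congr
        (fun b hb => congrArg g (hf1 b hb).symm) (congrArg g (hf1 a ha).symm)
    -- The chosen data make T(g ∘ f) equal to Tg ∘ Tf by definition.
    · exact ih hV.tangent hgT hfT fun a ha => hm ha

/-- A bounded operator that is given on all levels is of class sc^k. -/
theorem IsScDiff.of_linear {E : ScBanach.{u}} {F : ScBanach.{v}} (k : ℕ) (U : Set (E.lvl 0))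
    (T : ∀ m, E.lvl m →L[ℝ] F.lvl m) (hT : ∀ m a, F.incl m (T (m + 1) a) = T m (E.incl m a)) :
    IsScDiff k E F U (T 0) := by
  induction k generalizing E F with
  | zero =>
    have h : ∀ m a, F.emb m (T m a) = T 0 (E.emb m a) := by
      intro m
      induction m with
      | zero => intro a; rfl
      | succ m ih => intro a; exact (congrArg (F.emb m) (hT m a)).trans (ih _)
    exact fun m => ⟨T m, (T m).continuous.continuousOn, fun a _ => h m a⟩
  | succ k ih =>
    refine ⟨(ih U T hT).isSc0, T 1, fun _ => T 0, fun a _ => hT 0 a,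
      fun a _ => ((T 0).comp (E.incl 0)).hasFDerivWithinAt, ?_⟩
    -- The tangent map of a linear map is again linear, given on level `m` by `T (m + 1)` and `T m`.
    exact ih (E := E.tangent) (F := F.tangent) _ (fun m => (T (m + 1)).prodMap (T m))
      fun m a => Prod.ext (hT (m + 1) a.1) (hT m a.2)

theorem IsSc0.prodMk {f : E.lvl 0 → F.lvl 0} {g : E.lvl 0 → G.lvl 0} (hf : IsSc0 E F U f)
    (hg : IsSc0 E G U g) : IsSc0 E (F.prod G) U (fun a => (f a, g a)) := fun m => by
  obtain ⟨f', hf', hff⟩ := hf m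
  obtain ⟨g', hg', hgg⟩ := hg m
  refine ⟨fun a => (f' a, g' a), hf'.prodMk hg', fun a ha => ?_⟩
  rw [ScBanach.emb_prod, hff a ha, hgg a ha]

theorem IsScDiff.prodMk {k : ℕ} {E : ScBanach.{u}} {F : ScBanach.{v}} {G : ScBanach.{w}}
    {U : Set (E.lvl 0)} {f : E.lvl 0 → F.lvl 0} {g : E.lvl 0 → G.lvl 0}
    (hf : IsScDiff k E F U f) (hg : IsScDiff k E G U g) :
    IsScDiff k E (F.prod G) U (fun a => (f a, g a)) := by
  induction k generalizing E F G with
  | zero => exact IsSc0.prodMk hf hg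
  | succ k ih =>
    obtain ⟨hf0, f₁, Df, hf1, hfD, hfT⟩ := hf
    obtain ⟨hg0, g₁, Dg, hg1, hgD, hgT⟩ := hg
    refine ⟨hf0.prodMk hg0, fun a => (f₁ a, g₁ a), fun a => (Df a).prod (Dg a),
      fun a ha => Prod.ext (hf1 a ha) (hg1 a ha), fun a ha => (hfD a ha).prodMk (hgD a ha), ?_⟩
    -- Pairing the tangent maps lands in TF ⊕ TG, not in T(F ⊕ G); `T` exchanges the two middle
    -- coordinates.
    let T : ∀ m, (F.tangent.prod G.tangent).lvl m →L[ℝ] (F.prod G).tangent.lvl m := fun m =>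
      ((ContinuousLinearMap.fst ℝ (F.lvl (m + 1)) (F.lvl m)).prodMap
        (ContinuousLinearMap.fst ℝ (G.lvl (m + 1)) (G.lvl m))).prod
      ((ContinuousLinearMap.snd ℝ (F.lvl (m + 1)) (F.lvl m)).prodMap
        (ContinuousLinearMap.snd ℝ (G.lvl (m + 1)) (G.lvl m)))
    exact IsScDiff.comp IsScRegular.univ (IsScDiff.of_linear k univ T fun m a => rfl) (ih hfT hgT)
      (mapsTo_univ _ _)

/-- The embedding of each level is injective, so the lift of a value to level `m` is unique. A
pointwise choice therefore agrees with every local continuous representative. -/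
theorem IsSc0.of_locally {f : E.lvl 0 → F.lvl 0}
    (h : ∀ a ∈ U, ∃ O : Set (E.lvl 0), IsOpen O ∧ a ∈ O ∧ IsSc0 E F (O ∩ U) f) :
    IsSc0 E F U f := fun m => by
  have h' : ∀ a : E.lvl m, a ∈ scLevel E U m → ∃ O : Set (E.lvl 0), IsOpen O ∧ E.emb m a ∈ O ∧
      ∃ g : E.lvl m → F.lvl m, ContinuousOn g (scLevel E (O ∩ U) m) ∧
        ∀ b ∈ scLevel E (O ∩ U) m, F.emb m (g b) = f (E.emb m b) := fun a ha => by
    obtain ⟨O, hO, haO, hf⟩ := h _ ha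
    exact ⟨O, hO, haO, hf m⟩
  have hex : ∀ a : E.lvl m, ∃ b : F.lvl m, a ∈ scLevel E U m → F.emb m b = f (E.emb m a) := by
    intro a
    by_cases ha : a ∈ scLevel E U m
    · obtain ⟨O, _, haO, g, _, hg⟩ := h' a ha
      exact ⟨g a, fun _ => hg a ⟨haO, ha⟩⟩
    · exact ⟨0, fun h => absurd h ha⟩
  choose g hg using hex
  refine ⟨g, fun a ha => ?_, hg⟩
  obtain ⟨O, hO, haO, g', hgc, hg'⟩ := h' a ha
  have hc : ContinuousWithinAt g (scLevel E (O ∩ U) m) a :=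
    (hgc a ⟨haO, ha⟩).congr
      (fun b hb => F.emb_injective m ((hg b hb.2).trans (hg' b hb).symm))
      (F.emb_injective m ((hg a ha).trans (hg' a ⟨haO, ha⟩).symm))
  refine hc.mono_of_mem_nhdsWithin ?_
  exact Filter.inter_mem (mem_nhdsWithin_of_mem_nhds
    ((hO.preimage (E.emb m).continuous).mem_nhds haO)) self_mem_nhdsWithin

/-- Being of class sc^k is a local property. -/
theorem IsScDiff.of_locally {k : ℕ} {E : ScBanach.{u}} {F : ScBanach.{v}} {U : Set (E.lvl 0)}
    {f : E.lvl 0 → F.lvl 0} (hU : IsScRegular E U)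
    (h : ∀ a ∈ U, ∃ O : Set (E.lvl 0), IsOpen O ∧ a ∈ O ∧ IsScDiff k E F (O ∩ U) f) :
    IsScDiff k E F U f := by
  induction k generalizing E F with
  | zero => exact IsSc0.of_locally h
  | succ k ih =>
    have hex : ∀ a : E.lvl 1, ∃ (b : F.lvl 1) (D : E.lvl 0 →L[ℝ] F.lvl 0), a ∈ scLevel E U 1 →
        F.incl 0 b = f (E.incl 0 a) ∧ HasFDerivWithinAt (fun b => f (E.incl 0 b))
          (D.comp (E.incl 0)) (scLevel E U 1) a := by
      intro a
      by_cases ha : a ∈ scLevel E U 1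
      · obtain ⟨O, hO, haO, _, f₁, Df, h1, hD, _⟩ := h _ ha
        refine ⟨f₁ a, Df a, fun _ => ⟨h1 a ⟨haO, ha⟩, ?_⟩⟩
        refine (hD a ⟨haO, ha⟩).mono_of_mem_nhdsWithin ?_
        exact Filter.inter_mem (mem_nhdsWithin_of_mem_nhds
          ((hO.preimage (E.incl 0).continuous).mem_nhds haO)) self_mem_nhdsWithin
      · exact ⟨0, 0, fun h => absurd h ha⟩
    choose f₁ Df hfD using hex
    refine ⟨IsSc0.of_locally fun a ha => ?_, f₁, Df, fun a ha => (hfD a ha).1,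
      fun a ha => (hfD a ha).2, ih hU.tangent fun a ha => ?_⟩
    · obtain ⟨O, hO, haO, hf⟩ := h a ha
      exact ⟨O, hO, haO, hf.1⟩
    · obtain ⟨O, hO, haO, _, f₁', Df', h1, hD, hT⟩ := h _ ha
      refine ⟨{b | E.incl 0 b.1 ∈ O}, hO.preimage ((E.incl 0).continuous.comp continuous_fst),
        haO, hT.congr fun b hb => ?_⟩
      have hb' : b.1 ∈ scLevel E (O ∩ U) 1 := hb
      have e1 : f₁ b.1 = f₁' b.1 :=
        F.incl_injective 0 ((hfD _ hb'.2).1.trans (h1 _ hb').symm)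
      -- Unique differentiability on level one identifies the chosen and the local derivative on E₁;
      -- density of E₁ in E₀ then identifies them on E₀.
      have e2 : (Df b.1).comp (E.incl 0) = (Df' b.1).comp (E.incl 0) :=
        ((hU.inter_open hO).uniqueDiffOn 1 b.1 hb').eq
          ((hfD _ hb'.2).2.mono fun c hc => hc.2) (hD _ hb')
      have e3 : Df b.1 = Df' b.1 := by
        apply ContinuousLinearMap.coeFn_injective
        refine (E.denseRange_incl 0).equalizer (Df b.1).continuous (Df' b.1).continuous ?_
        exact congrArg DFunLike.coe e2
      show (f₁ b.1, Df b.1 b.2) = (f₁' b.1, Df' b.1 b.2)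
      rw [e1, e3]

/-! ### Sc-smooth maps -/

theorem IsScSmooth.continuousOn {f : E.lvl 0 → F.lvl 0} (hf : IsScSmooth E F U f) :
    ContinuousOn f U := (hf 0).isSc0.continuousOn

theorem IsScSmooth.congr {f f' : E.lvl 0 → F.lvl 0} (hf : IsScSmooth E F U f) (h : EqOn f' f U) :
    IsScSmooth E F U f' := fun k => (hf k).congr h

theorem IsScSmooth.mono {f : E.lvl 0 → F.lvl 0} (hf : IsScSmooth E F U f) (h : U' ⊆ U) :
    IsScSmooth E F U' f := fun k => (hf k).mono h

theorem IsScSmooth.comp {f : E.lvl 0 → F.lvl 0} {g : F.lvl 0 → G.lvl 0} (hV : IsScRegular F V)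
    (hg : IsScSmooth F G V g) (hf : IsScSmooth E F U f) (h : MapsTo f U V) :
    IsScSmooth E G U (g ∘ f) := fun k => IsScDiff.comp hV (hg k) (hf k) h

theorem IsScSmooth.prodMk {f : E.lvl 0 → F.lvl 0} {g : E.lvl 0 → G.lvl 0}
    (hf : IsScSmooth E F U f) (hg : IsScSmooth E G U g) :
    IsScSmooth E (F.prod G) U (fun a => (f a, g a)) := fun k => (hf k).prodMk (hg k)

theorem IsScSmooth.of_locally {f : E.lvl 0 → F.lvl 0} (hU : IsScRegular E U)
    (h : ∀ a ∈ U, ∃ O : Set (E.lvl 0), IsOpen O ∧ a ∈ O ∧ IsScSmooth E F (O ∩ U) f) :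
    IsScSmooth E F U f := fun k => IsScDiff.of_locally hU fun a ha => by
  obtain ⟨O, hO, haO, hf⟩ := h a ha
  exact ⟨O, hO, haO, hf k⟩

theorem isScSmooth_fst (U : Set ((E.prod F).lvl 0)) :
    IsScSmooth (E.prod F) E U (fun a => a.1) := fun k =>
  IsScDiff.of_linear k U (fun m => ContinuousLinearMap.fst ℝ (E.lvl m) (F.lvl m)) fun _ _ => rfl

theorem isScSmooth_snd (U : Set ((E.prod F).lvl 0)) :
    IsScSmooth (E.prod F) F U (fun a => a.2) := fun k =>
  IsScDiff.of_linear k U (fun m => ContinuousLinearMap.snd ℝ (E.lvl m) (F.lvl m)) fun _ _ => rfl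

theorem IsScSmooth.fst {f : E.lvl 0 → (F.prod G).lvl 0} (hf : IsScSmooth E (F.prod G) U f) :
    IsScSmooth E F U (fun a => (f a).1) :=
  IsScSmooth.comp IsScRegular.univ (isScSmooth_fst univ) hf (mapsTo_univ _ _)

theorem IsScSmooth.snd {f : E.lvl 0 → (F.prod G).lvl 0} (hf : IsScSmooth E (F.prod G) U f) :
    IsScSmooth E G U (fun a => (f a).2) :=
  IsScSmooth.comp IsScRegular.univ (isScSmooth_snd univ) hf (mapsTo_univ _ _)

end ScCalculus

/-! ### Retraction models -/

/-- The properties of the models given by splicings: the retraction is an sc-smooth idempotent map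
of a regular domain. -/
structure ScModel.IsRegular (M : ScModel.{u}) : Prop where
  dom : IsScRegular M.space M.dom
  smooth : IsScSmooth M.space M.space M.dom M.ret
  mapsTo : MapsTo M.ret M.dom M.dom
  idem : ∀ a ∈ M.dom, M.ret (M.ret a) = M.ret a

theorem IsOpenIn.subset {T : Type u} [TopologicalSpace T] {A B : Set T} (h : IsOpenIn A B) :
    A ⊆ B := by
  obtain ⟨G, -, rfl⟩ := h
  exact inter_subset_right

theorem IsOpenIn.open_inter {T : Type u} [TopologicalSpace T] {A B G : Set T} (h : IsOpenIn A B)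
    (hG : IsOpen G) : IsOpenIn (G ∩ A) B := by
  obtain ⟨G', hG', rfl⟩ := h
  exact ⟨G ∩ G', hG.inter hG', (inter_assoc _ _ _).symm⟩

theorem IsOpenIn.preimage {T : Type u} {T' : Type v} [TopologicalSpace T] [TopologicalSpace T']
    {A B : Set T} {A' B' : Set T'} {f : T → T'} (h : IsOpenIn A B) (h' : IsOpenIn A' B')
    (hf : ContinuousOn f A) (hm : MapsTo f A B') : IsOpenIn {a | a ∈ A ∧ f a ∈ A'} B := by
  obtain ⟨G', hG', rfl⟩ := h'
  obtain ⟨O, hO, hOA⟩ := continuousOn_iff'.1 hf G' hG'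
  have : {a | a ∈ A ∧ f a ∈ G' ∩ B'} = O ∩ A := by
    rw [← hOA]
    ext a
    exact ⟨fun h => ⟨h.2.1, h.1⟩, fun h => ⟨h.2, h.1, hm h.2⟩⟩
  rw [this]
  exact h.open_inter hO

theorem IsOpen.isOpenIn_univ {T : Type u} [TopologicalSpace T] {A : Set T} (h : IsOpen A) :
    IsOpenIn A univ := ⟨A, h, (inter_univ A).symm⟩

theorem IsOpenIn.refl {T : Type u} [TopologicalSpace T] (A : Set T) : IsOpenIn A A :=
  ⟨univ, isOpen_univ, (univ_inter A).symm⟩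

namespace ScModel

variable {M N P : ScModel.{u}} {A B : Set (M.space.lvl 0)}

theorem IsRegular.ret_mem_core (hM : M.IsRegular) {a : M.space.lvl 0} (ha : a ∈ M.dom) :
    M.ret a ∈ M.core := ⟨hM.mapsTo ha, hM.idem a ha⟩

theorem mem_hat_of_mem_core {a : M.space.lvl 0} (ha : a ∈ M.core) (haA : a ∈ A) : a ∈ M.hat A :=
  ⟨ha.1, by rwa [ha.2]⟩

theorem hat_mono (h : A ⊆ B) : M.hat A ⊆ M.hat B := fun _ ha => ⟨ha.1, h ha.2⟩

theorem IsRegular.isOpenIn_hat (hM : M.IsRegular) (hA : IsOpenIn A M.core) :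
    IsOpenIn (M.hat A) M.dom :=
  (IsOpenIn.refl M.dom).preimage hA hM.smooth.continuousOn fun _ ha => hM.ret_mem_core ha

theorem IsRegular.isScRegular_hat (hM : M.IsRegular) (hA : IsOpenIn A M.core) :
    IsScRegular M.space (M.hat A) := (hM.isOpenIn_hat hA).isScRegular hM.dom

end ScModel

namespace IsScSmoothBetween

variable {M N P : ScModel.{u}} {A A' : Set (M.space.lvl 0)} {B : Set (N.space.lvl 0)}
  {g g' : M.space.lvl 0 → N.space.lvl 0} {h : N.space.lvl 0 → P.space.lvl 0}

theorem mono (hg : IsScSmoothBetween M N A g) (hA : A' ⊆ A) : IsScSmoothBetween M N A' g :=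
  IsScSmooth.mono hg (ScModel.hat_mono hA)

theorem congr (hg : IsScSmoothBetween M N A g) (h : EqOn g' g A) : IsScSmoothBetween M N A g' :=
  IsScSmooth.congr hg fun _ ha => h ha.2

theorem continuousOn (hg : IsScSmoothBetween M N A g) (hA : A ⊆ M.core) : ContinuousOn g A :=
  ((IsScSmooth.continuousOn hg).mono fun _ ha => ScModel.mem_hat_of_mem_core (hA ha) ha).congr
    fun _ ha => congrArg g (hA ha).2.symm

/-- The extension of the identity to the domain is the retraction itself. -/
theorem refl (hM : M.IsRegular) (A : Set (M.space.lvl 0)) : IsScSmoothBetween M M A id :=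
  hM.smooth.mono fun _ ha => ha.1

/-- Since `g` lands in the core of `N`, where the retraction is the identity, the composite of the
extensions of `h` and `g` is the extension of `h ∘ g`. The chain rule thus applies on open domains
of the retractions. -/
theorem comp (hN : N.IsRegular) (hB : IsOpenIn B N.core) (hh : IsScSmoothBetween N P B h)
    (hg : IsScSmoothBetween M N A g) (hm : MapsTo g A B) : IsScSmoothBetween M P A (h ∘ g) := by
  have key := IsScSmooth.comp (hN.isScRegular_hat hB) hh hg fun a ha =>
    ScModel.mem_hat_of_mem_core (hB.subset (hm ha.2)) (hm ha.2)
  refine IsScSmooth.congr key fun a ha => ?_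
  exact congrArg h (hB.subset (hm ha.2)).2.symm

theorem of_locally (hM : M.IsRegular) (hA : IsOpenIn A M.core)
    (h : ∀ a ∈ A, ∃ O : Set (M.space.lvl 0), IsOpen O ∧ a ∈ O ∧ IsScSmoothBetween M N (O ∩ A) g) :
    IsScSmoothBetween M N A g := by
  refine IsScSmooth.of_locally (hM.isScRegular_hat hA) fun a ha => ?_
  obtain ⟨O, hO, haO, hg⟩ := h _ ha.2
  -- The cover lives on the core but locality is needed on its hat; `O'` cuts out the preimage of
  -- `O` under the retraction, which is continuous only on `dom`.
  obtain ⟨O', hO', hOO⟩ := continuousOn_iff'.1 hM.smooth.continuousOn O hO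
  have hmem : ∀ b ∈ M.dom, b ∈ O' ↔ M.ret b ∈ O := fun b hb =>
    ⟨fun h => ((Set.ext_iff.1 hOO b).2 ⟨h, hb⟩).1, fun h => ((Set.ext_iff.1 hOO b).1 ⟨h, hb⟩).1⟩
  refine ⟨O', hO', (hmem a ha.1).2 haO, IsScSmooth.mono hg fun b hb => ?_⟩
  exact ⟨hb.2.1, (hmem b hb.2.1).1 hb.1, hb.2.2⟩

end IsScSmoothBetween

theorem ScSplicing.isRegular (S : ScSplicing.{u}) : S.model.IsRegular where
  dom := (S.isOpenIn.isScRegular S.quadrant.isScRegular).prod S.E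
  smooth := (isScSmooth_fst _).prodMk S.smooth
  mapsTo _ ha := ha
  idem a ha := Prod.ext rfl (S.idem a.1 ha a.2)

theorem LocalModel.isScRegular (L : LocalModel.{u}) : IsScRegular L.space (L.S.model.hat L.O) :=
  L.S.isRegular.isScRegular_hat L.isOpenIn

theorem LocalModel.ret_of_mem (L : LocalModel.{u}) {a : L.space.lvl 0} (ha : a ∈ L.O) :
    L.S.model.ret a = a := (L.isOpenIn.subset ha).2

namespace GeneralSplicing

variable {L : LocalModel.{u}} {F : ScBanach.{u}} (R : GeneralSplicing L F)

theorem isRegular : R.model.IsRegular where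
  dom := L.isScRegular.prod F
  smooth := (IsScSmooth.comp L.S.isRegular.dom L.S.isRegular.smooth (isScSmooth_fst _)
    fun _ ha => ha.1).prodMk R.smooth
  mapsTo a ha := ScModel.mem_hat_of_mem_core (L.isOpenIn.subset ha.2) ha.2
  idem a ha := by
    have h := L.ret_of_mem ha.2
    refine Prod.ext h ?_
    show R.ρ (L.S.model.ret (L.S.model.ret a.1)) (R.ρ (L.S.model.ret a.1) a.2) = _
    rw [h]
    exact R.idem _ ha.2 _

/-- Being fixed by the retraction fixes the base component, so the base point lies in `L.O` and ρ
may be evaluated there without retracting. -/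
theorem mem_core {a : L.space.lvl 0 × F.lvl 0} :
    a ∈ R.model.core ↔ a.1 ∈ L.O ∧ R.ρ a.1 a.2 = a.2 := by
  constructor
  · rintro ⟨h1, h2⟩
    have e1 : L.S.model.ret a.1 = a.1 := congrArg Prod.fst h2
    have e2 : R.ρ (L.S.model.ret a.1) a.2 = a.2 := congrArg Prod.snd h2
    have h3 : L.S.model.ret a.1 ∈ L.O := h1.2
    rw [e1] at h3 e2
    exact ⟨h3, e2⟩
  · rintro ⟨h1, h2⟩
    have e1 := L.ret_of_mem h1
    refine ⟨ScModel.mem_hat_of_mem_core (L.isOpenIn.subset h1) h1, Prod.ext e1 ?_⟩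
    show R.ρ (L.S.model.ret a.1) a.2 = _
    rw [e1, h2]

theorem isOpenIn_core {A : Set (L.space.lvl 0)} (hA : IsOpenIn A L.S.model.core) :
    IsOpenIn {a | a ∈ R.model.core ∧ a.1 ∈ A} R.model.core :=
  (IsOpenIn.refl _).preimage hA continuous_fst.continuousOn
    fun _ ha => L.isOpenIn.subset (R.mem_core.1 ha).1

end GeneralSplicing

theorem TypeOneSplicing.isRegular (T : TypeOneSplicing.{u}) : T.model.IsRegular := T.R.isRegular

/-! ### Charts -/

namespace ScChart

variable {X : Type v} [TopologicalSpace X] {M N P : ScModel.{u}}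

theorem target_subset (c : ScChart X M) : c.target ⊆ M.core := c.target_open.subset

theorem isOpenIn_target_inter (c : ScChart X M) {O : Set X} (hO : IsOpen O) :
    IsOpenIn {a | a ∈ c.target ∧ c.toPartialEquiv.symm a ∈ O} M.core :=
  c.target_open.preimage hO.isOpenIn_univ c.continuousOn_invFun (mapsTo_univ _ _)

/-- The restriction of a chart to an open set. -/
def restrict (c : ScChart X M) {O : Set X} (hO : IsOpen O) : ScChart X M where
  toPartialEquiv := c.toPartialEquiv.restr O
  open_source := c.open_source.inter hO
  target_open := c.isOpenIn_target_inter hO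
  continuousOn_toFun := c.continuousOn_toFun.mono inter_subset_left
  continuousOn_invFun := c.continuousOn_invFun.mono inter_subset_left

theorem Compatible.restrict {c : ScChart X M} {d : ScChart X N} (h : c.Compatible d) {O : Set X}
    (hO : IsOpen O) : (c.restrict hO).Compatible d :=
  ⟨IsScSmoothBetween.mono h.1 fun _ ha => ⟨ha.1.1, ha.2⟩,
    IsScSmoothBetween.mono h.2 fun _ ha => ⟨ha.1, ha.2.1⟩⟩

theorem Compatible.symm {c : ScChart X M} {d : ScChart X N} (h : c.Compatible d) :
    d.Compatible c := ⟨h.2, h.1⟩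

/-- A transition map that factors locally through charts with smooth transitions is smooth. -/
theorem TransitionSmooth.of_locally (hM : M.IsRegular) {c : ScChart X M} {d : ScChart X N}
    (h : ∀ a ∈ c.source, a ∈ d.source → ∃ (P : ScModel.{u}) (e : ScChart X P), P.IsRegular ∧
      a ∈ e.source ∧ c.TransitionSmooth e ∧ e.TransitionSmooth d) : c.TransitionSmooth d := by
  refine IsScSmoothBetween.of_locally hM (c.isOpenIn_target_inter d.open_source) fun a ha => ?_
  obtain ⟨P, e, hP, hae, hce, hed⟩ := h _ (c.map_target ha.1) ha.2
  obtain ⟨O, hO, hOe⟩ := c.isOpenIn_target_inter e.open_source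
  have hmem : ∀ b ∈ c.target, b ∈ O → c.toPartialEquiv.symm b ∈ e.source := fun b hb hbO =>
    ((Set.ext_iff.1 hOe b).2 ⟨hbO, c.target_subset hb⟩).2
  refine ⟨O, hO, ((Set.ext_iff.1 hOe a).1 ⟨ha.1, hae⟩).1, ?_⟩
  have hm : MapsTo (fun a => e.toPartialEquiv (c.toPartialEquiv.symm a))
      (O ∩ {a | a ∈ c.target ∧ c.toPartialEquiv.symm a ∈ d.source})
      {a | a ∈ e.target ∧ e.toPartialEquiv.symm a ∈ d.source} := fun b hb => by
    have hbe := hmem b hb.2.1 hb.1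
    refine ⟨e.map_source hbe, ?_⟩
    beta_reduce
    rw [e.left_inv hbe]
    exact hb.2.2
  refine (IsScSmoothBetween.comp hP (e.isOpenIn_target_inter d.open_source) hed
    (IsScSmoothBetween.mono hce fun b hb => ⟨hb.2.1, hmem b hb.2.1 hb.1⟩) hm).congr fun b hb => ?_
  show _ = d.toPartialEquiv (e.toPartialEquiv.symm (e.toPartialEquiv (c.toPartialEquiv.symm b)))
  rw [e.left_inv (hmem b hb.2.1 hb.1)]

theorem Compatible.of_locally (hM : M.IsRegular) (hN : N.IsRegular) {c : ScChart X M}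
    {d : ScChart X N}
    (h : ∀ a ∈ c.source, a ∈ d.source → ∃ (P : ScModel.{u}) (e : ScChart X P), P.IsRegular ∧
      a ∈ e.source ∧ c.Compatible e ∧ e.Compatible d) : c.Compatible d := by
  refine ⟨TransitionSmooth.of_locally hM fun a hc hd => ?_,
    TransitionSmooth.of_locally hN fun a hd hc => ?_⟩ <;>
  obtain ⟨P, e, hP, hae, hce, hed⟩ := h a hc hd
  exacts [⟨P, e, hP, hae, hce.1, hed.1⟩, ⟨P, e, hP, hae, hed.2, hce.2⟩]

end ScChart

/-! ### Maximal atlases and their generation by covering families. -/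

namespace ScAtlas

variable {ι : Type w} {M : ι → ScModel.{u}} {X : Type v} [TopologicalSpace X]

theorem restrict_mem (𝒳 : ScAtlas M X) {i : ι} {c : ScChart X (M i)} (hc : c ∈ 𝒳.atlas i)
    {O : Set X} (hO : IsOpen O) : c.restrict hO ∈ 𝒳.atlas i :=
  𝒳.maximal i _ fun j d hd => (𝒳.compatible i c hc j d hd).restrict hO

/-- A chart that is compatible with the charts of a covering family in the atlas is in the atlas. -/
theorem mem_of_locally (hM : ∀ i, (M i).IsRegular) (𝒳 : ScAtlas M X) {i : ι}
    {c : ScChart X (M i)}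
    (h : ∀ a ∈ c.source, ∃ j, ∃ e ∈ 𝒳.atlas j, a ∈ e.source ∧ c.Compatible e) :
    c ∈ 𝒳.atlas i := by
  refine 𝒳.maximal i c fun j d hd => ScChart.Compatible.of_locally (hM i) (hM j) fun a hc _ => ?_
  obtain ⟨k, e, he, hae, hce⟩ := h a hc
  exact ⟨_, e, hM k, hae, hce, 𝒳.compatible k e he j d hd⟩

/-- The maximal atlas that contains a given covering family of compatible charts. -/
def ofCharts (hM : ∀ i, (M i).IsRegular) (t2 : T2Space X) (sc : SecondCountableTopology X)
    (B : ∀ i, Set (ScChart X (M i))) (cover : ∀ a : X, ∃ i, ∃ c ∈ B i, a ∈ c.source)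
    (compatible : ∀ i, ∀ c ∈ B i, ∀ j, ∀ d ∈ B j, c.Compatible d) : ScAtlas M X where
  t2 := t2
  secondCountable := sc
  atlas i := {c | ∀ j, ∀ d ∈ B j, c.Compatible d}
  cover a := by
    obtain ⟨i, c, hc, ha⟩ := cover a
    exact ⟨i, c, compatible i c hc, ha⟩
  -- Near each point the transition factors through a chart of the covering family `B`.
  compatible i c hc j d hd := ScChart.Compatible.of_locally (hM i) (hM j) fun a _ _ => by
    obtain ⟨k, e, he, hae⟩ := cover a
    exact ⟨_, e, hM k, hae, hc k e he, (hd k e he).symm⟩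
  maximal i c hc j d hd := hc j d (compatible j d hd)

theorem mem_ofCharts (hM : ∀ i, (M i).IsRegular) (t2 : T2Space X) (sc : SecondCountableTopology X)
    (B : ∀ i, Set (ScChart X (M i))) (cover : ∀ a : X, ∃ i, ∃ c ∈ B i, a ∈ c.source)
    (compatible : ∀ i, ∀ c ∈ B i, ∀ j, ∀ d ∈ B j, c.Compatible d) {i : ι} {c : ScChart X (M i)}
    (hc : c ∈ B i) : c ∈ (ofCharts hM t2 sc B cover compatible).atlas i :=
  fun j d hd => compatible i c hc j d hd

/-- Two maximal atlases are equal if they have enough charts in common. -/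
theorem ext_of_cover (hM : ∀ i, (M i).IsRegular) {𝒳 𝒴 : ScAtlas M X}
    (h : ∀ a : X, ∃ i, ∃ c ∈ 𝒳.atlas i, c ∈ 𝒴.atlas i ∧ a ∈ c.source) : 𝒳 = 𝒴 := by
  have key : 𝒳.atlas = 𝒴.atlas := by
    funext i
    ext c
    constructor
    · intro hc
      refine 𝒴.mem_of_locally hM fun a _ => ?_
      obtain ⟨j, e, he, he', hae⟩ := h a
      exact ⟨j, e, he', hae, 𝒳.compatible i c hc j e he⟩
    · intro hc
      refine 𝒳.mem_of_locally hM fun a _ => ?_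
      obtain ⟨j, e, he, he', hae⟩ := h a
      exact ⟨j, e, he, hae, 𝒴.compatible i c hc j e he'⟩
  cases 𝒳
  cases 𝒴
  cases key
  rfl

end ScAtlas

/-! ### Sc-smooth maps in charts -/

section

variable {ι : Type w} {κ : Type x} {M : ι → ScModel.{u}} {N : κ → ScModel.{u}}
  {X : Type*} {Y : Type*} [TopologicalSpace X] [TopologicalSpace Y]
  {𝒳 : ScAtlas M X} {𝒴 : ScAtlas N Y} {f : X → Y}

theorem IsScSmoothMap.continuous (hf : IsScSmoothMap 𝒳 𝒴 f) : Continuous f := by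
  refine continuous_iff_continuousAt.2 fun a => ?_
  obtain ⟨i, c, hc, j, d, hd, ha, hm, hs⟩ := hf a
  have h1 := hs.continuousOn c.target_subset
  have hm1 : MapsTo (fun b => d.toPartialEquiv (f (c.toPartialEquiv.symm b))) c.target d.target :=
    fun b hb => d.map_source (hm (c.map_target hb))
  have h2 : ContinuousOn f c.source := by
    refine (d.continuousOn_invFun.comp (h1.comp c.continuousOn_toFun fun b hb => c.map_source hb)
      fun b hb => hm1 (c.map_source hb)).congr fun b hb => ?_
    show f b = d.toPartialEquiv.symm
      (d.toPartialEquiv (f (c.toPartialEquiv.symm (c.toPartialEquiv b))))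
    rw [c.left_inv hb, d.left_inv (hm hb)]
  exact h2.continuousAt (c.open_source.mem_nhds ha)

/-- An sc-smooth map is smooth with respect to any pair of charts of the maximal atlases. -/
theorem IsScSmoothMap.smoothBetween (hM : ∀ i, (M i).IsRegular) (hN : ∀ j, (N j).IsRegular)
    (hf : IsScSmoothMap 𝒳 𝒴 f) {i : ι} {c : ScChart X (M i)} (hc : c ∈ 𝒳.atlas i) {j : κ}
    {d : ScChart Y (N j)} (hd : d ∈ 𝒴.atlas j) (h : MapsTo f c.source d.source) :
    IsScSmoothBetween (M i) (N j) c.target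
      (fun b => d.toPartialEquiv (f (c.toPartialEquiv.symm b))) := by
  refine IsScSmoothBetween.of_locally (hM i) c.target_open fun a ha => ?_
  obtain ⟨i', c', hc', j', d', hd', hac, hm, hs⟩ := hf (c.toPartialEquiv.symm a)
  obtain ⟨O, hO, hOe⟩ := c.isOpenIn_target_inter c'.open_source
  have hmem : ∀ b ∈ c.target, b ∈ O → c.toPartialEquiv.symm b ∈ c'.source := fun b hb hbO =>
    ((Set.ext_iff.1 hOe b).2 ⟨hbO, c.target_subset hb⟩).2
  refine ⟨O, hO, ((Set.ext_iff.1 hOe a).1 ⟨ha, hac⟩).1, ?_⟩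
  -- On a small neighbourhood the map factors as the transition `c → c'`, the given smooth
  -- expression of `f`, and the transition `d' → d`.
  have s1 : IsScSmoothBetween _ _ (O ∩ c.target) _ :=
    (𝒳.compatible i c hc i' c' hc').1.mono fun b hb => ⟨hb.2, hmem b hb.2 hb.1⟩
  have s3 := (𝒴.compatible j' d' hd' j d hd).1
  have m1 : MapsTo (fun b => c'.toPartialEquiv (c.toPartialEquiv.symm b)) (O ∩ c.target)
      {b | b ∈ c'.target ∧ c'.toPartialEquiv.symm b ∈ c.source} := fun b hb => by
    have hb' := hmem b hb.2 hb.1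
    refine ⟨c'.map_source hb', ?_⟩
    beta_reduce
    rw [c'.left_inv hb']
    exact c.map_target hb.2
  have m2 : MapsTo (fun b => d'.toPartialEquiv (f (c'.toPartialEquiv.symm b)))
      {b | b ∈ c'.target ∧ c'.toPartialEquiv.symm b ∈ c.source}
      {b | b ∈ d'.target ∧ d'.toPartialEquiv.symm b ∈ d.source} := fun b hb => by
    have hb' := hm (c'.map_target hb.1)
    refine ⟨d'.map_source hb', ?_⟩
    beta_reduce
    rw [d'.left_inv hb']
    exact h hb.2
  have s23 := IsScSmoothBetween.comp (hN j') (d'.isOpenIn_target_inter d.open_source) s3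
    (hs.mono fun b hb => hb.1) m2
  refine (IsScSmoothBetween.comp (hM i') (c'.isOpenIn_target_inter c.open_source) s23 s1
    m1).congr fun b hb => ?_
  have hb' := hmem b hb.2 hb.1
  show _ = d.toPartialEquiv (d'.toPartialEquiv.symm (d'.toPartialEquiv (f
    (c'.toPartialEquiv.symm (c'.toPartialEquiv (c.toPartialEquiv.symm b))))))
  rw [c'.left_inv hb', d'.left_inv (hm hb')]

end

/-! ### Strong bundle maps between splicing cores -/

/-- As ρ on F¹ is a restriction and the inclusion is injective, the core of `R.one` is the trace of
the core of `R.zero`. Mapping conditions thus need checking on level zero only. -/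
theorem StrongSplicing.mem_core_one {L : LocalModel.{u}} {F : ScBanach.{u}}
    (R : StrongSplicing L F) {a : L.space.lvl 0 × F.lvl 1} :
    a ∈ R.one.model.core ↔ (a.1, F.incl 0 a.2) ∈ R.zero.model.core := by
  rw [R.one.mem_core, R.zero.mem_core]
  refine and_congr_right fun ha => ?_
  rw [← R.restricts _ ha]
  exact (F.incl_injective 0).eq_iff.symm

namespace IsScStrongSmooth

variable {L L' L'' : LocalModel.{u}} {F F' F'' : ScBanach.{u}} {R : StrongSplicing L F}
  {R' : StrongSplicing L' F'} {R'' : StrongSplicing L'' F''} {A A' : Set (L.space.lvl 0)}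
  {B : Set (L'.space.lvl 0)}
  {g g' : L.space.lvl 0 × F.lvl 0 → L'.space.lvl 0 × F'.lvl 0}
  {h : L'.space.lvl 0 × F'.lvl 0 → L''.space.lvl 0 × F''.lvl 0}

theorem mono (hg : IsScStrongSmooth R R' A g) (hA : A' ⊆ A) : IsScStrongSmooth R R' A' g := by
  obtain ⟨⟨φ, hφ⟩, h0, g₁, h1, h1s⟩ := hg
  exact ⟨⟨φ, fun a ha haA => hφ a ha (hA haA)⟩, h0.mono fun a ha => ⟨ha.1, hA ha.2⟩, g₁,
    fun a ha haA => h1 a ha (hA haA), h1s.mono fun a ha => ⟨ha.1, hA ha.2⟩⟩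

theorem congr (hg : IsScStrongSmooth R R' A g)
    (h : ∀ a ∈ R.zero.model.core, a.1 ∈ A → g' a = g a) : IsScStrongSmooth R R' A g' := by
  obtain ⟨⟨φ, hφ⟩, h0, g₁, h1, h1s⟩ := hg
  exact ⟨⟨φ, fun a ha haA => (congrArg Prod.fst (h a ha haA)).trans (hφ a ha haA)⟩,
    h0.congr fun a ha => h a ha.1 ha.2, g₁,
    fun a ha haA => (h _ (R.mem_core_one.1 ha) haA).trans (h1 a ha haA), h1s⟩

theorem comp (hB : IsOpenIn B L'.S.model.core) (hh : IsScStrongSmooth R' R'' B h)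
    (hg : IsScStrongSmooth R R' A g)
    (hm : ∀ a ∈ R.zero.model.core, a.1 ∈ A → g a ∈ R'.zero.model.core ∧ (g a).1 ∈ B) :
    IsScStrongSmooth R R'' A (h ∘ g) := by
  obtain ⟨⟨φ, hφ⟩, g0, g₁, g1, g1s⟩ := hg
  obtain ⟨⟨χ, hχ⟩, h0, h₁, h1, h1s⟩ := hh
  -- The level-one mapping property is not assumed; it is inherited from level zero.
  have hm1 : ∀ a ∈ R.one.model.core, a.1 ∈ A → g₁ a ∈ R'.one.model.core ∧ (g₁ a).1 ∈ B := by
    intro a ha haA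
    have := hm _ (R.mem_core_one.1 ha) haA
    rw [g1 a ha haA] at this
    exact ⟨R'.mem_core_one.2 this.1, this.2⟩
  refine ⟨⟨χ ∘ φ, fun a ha haA => ?_⟩, ?_, h₁ ∘ g₁, fun a ha haA => ?_, ?_⟩
  · rw [Function.comp_apply, hχ _ (hm a ha haA).1 (hm a ha haA).2, hφ a ha haA]; rfl
  · exact IsScSmoothBetween.comp R'.zero.isRegular (R'.zero.isOpenIn_core hB) h0 g0
      fun a ha => hm a ha.1 ha.2
  · rw [Function.comp_apply, g1 a ha haA]
    exact h1 _ (hm1 a ha haA).1 (hm1 a ha haA).2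
  · exact IsScSmoothBetween.comp R'.one.isRegular (R'.one.isOpenIn_core hB) h1s g1s
      fun a ha => hm1 a ha.1 ha.2

/-- Smoothness into a core sees only the ambient space of the target, so the target splicing `R'`
may be arbitrary over the same spaces. -/
theorem id (R R' : StrongSplicing L F) (A : Set (L.space.lvl 0)) :
    IsScStrongSmooth R R' A (fun a => a) :=
  ⟨⟨fun a => a, fun _ _ _ => rfl⟩, IsScSmoothBetween.refl R.zero.isRegular _, fun a => a,
    fun _ _ _ => rfl, IsScSmoothBetween.refl R.one.isRegular _⟩

theorem of_locally (hA : IsOpenIn A L.S.model.core)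
    (hφ : ∃ φ : L.space.lvl 0 → L'.space.lvl 0, ∀ a ∈ R.zero.model.core, a.1 ∈ A → (g a).1 = φ a.1)
    (h : ∀ a ∈ A, ∃ O : Set (L.space.lvl 0), IsOpen O ∧ a ∈ O ∧ IsScStrongSmooth R R' (O ∩ A) g) :
    IsScStrongSmooth R R' A g := by
  -- The local level-one maps glue because `F'.incl 0` is injective; off the core over `A` the value
  -- is irrelevant.
  have hex : ∀ a : L.space.lvl 0 × F.lvl 1, ∃ b : L'.space.lvl 0 × F'.lvl 1,
      a ∈ R.one.model.core → a.1 ∈ A → g (a.1, F.incl 0 a.2) = (b.1, F'.incl 0 b.2) := by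
    intro a
    by_cases ha : a ∈ R.one.model.core ∧ a.1 ∈ A
    · obtain ⟨O, _, haO, _, _, g₁, h1, _⟩ := h _ ha.2
      exact ⟨g₁ a, fun _ _ => h1 a ha.1 ⟨haO, ha.2⟩⟩
    · exact ⟨0, fun h1 h2 => absurd ⟨h1, h2⟩ ha⟩
  choose g₁ hg₁ using hex
  refine ⟨hφ, ?_, g₁, hg₁, ?_⟩
  · refine IsScSmoothBetween.of_locally R.zero.isRegular (R.zero.isOpenIn_core hA) fun a ha => ?_
    obtain ⟨O, hO, haO, _, h0, _⟩ := h _ ha.2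
    exact ⟨{b : L.space.lvl 0 × F.lvl 0 | b.1 ∈ O}, hO.preimage continuous_fst, haO,
      h0.mono fun b hb => ⟨hb.2.1, hb.1, hb.2.2⟩⟩
  · refine IsScSmoothBetween.of_locally R.one.isRegular (R.one.isOpenIn_core hA) fun a ha => ?_
    obtain ⟨O, hO, haO, _, _, g₁', h1, h1s⟩ := h _ ha.2
    have hs : IsScSmoothBetween R.one.model R'.one.model
        ({b : L.space.lvl 0 × F.lvl 1 | b.1 ∈ O} ∩ {a | a ∈ R.one.model.core ∧ a.1 ∈ A}) g₁' :=
      h1s.mono fun b hb => ⟨hb.2.1, hb.1, hb.2.2⟩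
    refine ⟨{b : L.space.lvl 0 × F.lvl 1 | b.1 ∈ O}, hO.preimage continuous_fst, haO,
      hs.congr fun b hb => ?_⟩
    have e := Prod.mk.inj ((hg₁ b hb.2.1 hb.2.2).symm.trans (h1 b hb.2.1 ⟨hb.1, hb.2.2⟩))
    exact Prod.ext e.1 (F'.incl_injective 0 e.2)

end IsScStrongSmooth

/-! ### Strong bundle charts -/

namespace StrongBundleChart

variable {X : Type v} {Z : Type w} [TopologicalSpace X] [TopologicalSpace Z] {p : Z → X}
  {L L' : LocalModel.{u}} {F F' : ScBanach.{u}} {R : StrongSplicing L F} {R' : StrongSplicing L' F'}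

theorem mem_total_source (c : StrongBundleChart p R) {z : Z} :
    z ∈ c.total.source ↔ p z ∈ c.base.source := by
  rw [c.total_source]; rfl

theorem mem_total_target (c : StrongBundleChart p R) {a : L.space.lvl 0 × F.lvl 0} :
    a ∈ c.total.target ↔ a ∈ R.zero.model.core := by
  rw [c.total_target]

theorem symm_mem (c : StrongBundleChart p R) {a : L.space.lvl 0 × F.lvl 0}
    (ha : a ∈ R.zero.model.core) : c.total.toPartialEquiv.symm a ∈ c.total.source :=
  c.total.map_target (c.mem_total_target.2 ha)

theorem proj_symm_mem (c : StrongBundleChart p R) {a : L.space.lvl 0 × F.lvl 0}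
    (ha : a ∈ R.zero.model.core) : p (c.total.toPartialEquiv.symm a) ∈ c.base.source :=
  c.mem_total_source.1 (c.symm_mem ha)

theorem apply_symm (c : StrongBundleChart p R) {a : L.space.lvl 0 × F.lvl 0}
    (ha : a ∈ R.zero.model.core) : c.total.toPartialEquiv (c.total.toPartialEquiv.symm a) = a :=
  c.total.right_inv (c.mem_total_target.2 ha)

theorem apply_mem_core (c : StrongBundleChart p R) {z : Z} (hz : p z ∈ c.base.source) :
    c.total.toPartialEquiv z ∈ R.zero.model.core :=
  c.mem_total_target.1 (c.total.map_source (c.mem_total_source.2 hz))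

theorem proj_symm (c : StrongBundleChart p R) {a : L.space.lvl 0 × F.lvl 0}
    (ha : a ∈ R.zero.model.core) :
    p (c.total.toPartialEquiv.symm a) = c.base.toPartialEquiv.symm a.1 := by
  have hz := c.symm_mem ha
  have h := c.covers _ hz
  rw [c.apply_symm ha] at h
  rw [h, c.base.left_inv (c.mem_total_source.1 hz)]

/-- A transition map that factors locally through strong bundle charts with sc_◁-smooth transitions
is sc_◁-smooth. -/
theorem TransitionSmooth.of_locally {c : StrongBundleChart p R} {d : StrongBundleChart p R'}
    (h : ∀ a ∈ c.base.source, a ∈ d.base.source → ∃ (L'' : LocalModel.{u}) (F'' : ScBanach.{u})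
      (R'' : StrongSplicing L'' F'') (e : StrongBundleChart p R''),
      a ∈ e.base.source ∧ c.TransitionSmooth e ∧ e.TransitionSmooth d) : c.TransitionSmooth d := by
  refine IsScStrongSmooth.of_locally (c.base.isOpenIn_target_inter d.base.open_source)
    ⟨fun b => d.base.toPartialEquiv (c.base.toPartialEquiv.symm b), fun b hb hbA => ?_⟩
    fun a ha => ?_
  · rw [d.covers _ (d.mem_total_source.2 (by rw [c.proj_symm hb]; exact hbA.2)), c.proj_symm hb]
  obtain ⟨L'', F'', R'', e, hae, hce, hed⟩ := h _ (c.base.map_target ha.1) ha.2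
  obtain ⟨O, hO, hOe⟩ := c.base.isOpenIn_target_inter e.base.open_source
  have hmem : ∀ b ∈ c.base.target, b ∈ O → c.base.toPartialEquiv.symm b ∈ e.base.source :=
    fun b hb hbO => ((Set.ext_iff.1 hOe b).2 ⟨hbO, c.base.target_subset hb⟩).2
  refine ⟨O, hO, ((Set.ext_iff.1 hOe a).1 ⟨ha.1, hae⟩).1, ?_⟩
  have hpe : ∀ b ∈ R.zero.model.core, b.1 ∈ O ∩ {a | a ∈ c.base.target ∧
      c.base.toPartialEquiv.symm a ∈ d.base.source} →
      p (c.total.toPartialEquiv.symm b) ∈ e.base.source := fun b hb hbO => by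
    rw [c.proj_symm hb]
    exact hmem _ hbO.2.1 hbO.1
  refine (IsScStrongSmooth.comp (e.base.isOpenIn_target_inter d.base.open_source) hed
    (IsScStrongSmooth.mono hce fun b hb => ⟨hb.2.1, hmem b hb.2.1 hb.1⟩)
    fun b hb hbO => ⟨e.apply_mem_core (hpe b hb hbO), ?_⟩).congr fun b hb hbO => ?_
  · rw [e.covers _ (e.mem_total_source.2 (hpe b hb hbO))]
    refine ⟨e.base.map_source (hpe b hb hbO), ?_⟩
    rw [e.base.left_inv (hpe b hb hbO), c.proj_symm hb]
    exact hbO.2.2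
  · show _ = d.total.toPartialEquiv (e.total.toPartialEquiv.symm
      (e.total.toPartialEquiv (c.total.toPartialEquiv.symm b)))
    rw [e.total.left_inv (e.mem_total_source.2 (hpe b hb hbO))]

theorem Compatible.symm {c : StrongBundleChart p R} {d : StrongBundleChart p R'}
    (h : c.Compatible d) : d.Compatible c := ⟨h.2, h.1⟩

theorem Compatible.of_locally {c : StrongBundleChart p R} {d : StrongBundleChart p R'}
    (h : ∀ a ∈ c.base.source, a ∈ d.base.source → ∃ (L'' : LocalModel.{u}) (F'' : ScBanach.{u})
      (R'' : StrongSplicing L'' F'') (e : StrongBundleChart p R''),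
      a ∈ e.base.source ∧ c.Compatible e ∧ e.Compatible d) : c.Compatible d := by
  refine ⟨TransitionSmooth.of_locally fun a hc hd => ?_,
    TransitionSmooth.of_locally fun a hd hc => ?_⟩ <;>
  obtain ⟨L'', F'', R'', e, hae, hce, hed⟩ := h a hc hd
  exacts [⟨L'', F'', R'', e, hae, hce.1, hed.1⟩, ⟨L'', F'', R'', e, hae, hed.2, hce.2⟩]

end StrongBundleChart

/-! ### Pullback of splicings -/

/-- The general splicing `ρ'(w, u) = ρ(θ(w), u)` for an sc-smooth map `θ` of the bases. -/
def GeneralSplicing.pullback {L L' : LocalModel.{u}} {F : ScBanach.{u}} (R : GeneralSplicing L F)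
    (θ : L'.space.lvl 0 → L.space.lvl 0)
    (hθ : IsScSmoothBetween L'.S.model L.S.model L'.O θ) (hm : MapsTo θ L'.O L.O) :
    GeneralSplicing L' F where
  ρ a := R.ρ (θ a)
  idem a ha := R.idem _ (hm ha)
  smooth := by
    have h1 : IsScSmooth (L'.space.prod F) (L.space.prod F) {a | a.1 ∈ L'.S.model.hat L'.O}
        (fun a => (θ (L'.S.model.ret a.1), a.2)) :=
      (IsScSmooth.comp L'.isScRegular hθ (isScSmooth_fst _) fun _ ha => ha).prodMk
        (isScSmooth_snd _)
    -- The new splicing map is the old extended one composed with θ × id: `θ` has values in `L.O`,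
    -- where the retraction built into `R.smooth` is the identity.
    refine (IsScSmooth.comp (L.isScRegular.prod F) R.smooth h1 fun a ha => ?_).congr fun a ha => ?_
    · exact ScModel.mem_hat_of_mem_core (L.isOpenIn.subset (hm ha.2)) (hm ha.2)
    · show R.ρ _ a.2 = R.ρ (L.S.model.ret (θ (L'.S.model.ret a.1))) a.2
      rw [L.ret_of_mem (hm ha.2)]

/-- The strong bundle splicing `ρ'(w, u) = ρ(θ(w), u)` for an sc-smooth map `θ` of the bases. -/
def StrongSplicing.pullback {L L' : LocalModel.{u}} {F : ScBanach.{u}} (R : StrongSplicing L F)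
    (θ : L'.space.lvl 0 → L.space.lvl 0)
    (hθ : IsScSmoothBetween L'.S.model L.S.model L'.O θ) (hm : MapsTo θ L'.O L.O) :
    StrongSplicing L' F where
  zero := R.zero.pullback θ hθ hm
  one := R.one.pullback θ hθ hm
  restricts _ ha := R.restricts _ (hm ha)

theorem GeneralSplicing.smoothBetween_fst {L : LocalModel.{u}} {F : ScBanach.{u}}
    (R : GeneralSplicing L F) (A : Set (L.space.lvl 0 × F.lvl 0)) :
    IsScSmoothBetween R.model L.S.model A (fun a => a.1) :=
  (R.isRegular.smooth.mono fun _ ha => ha.1).fst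

/-- A pullback chart joins a chart of Y to the fibre part of a chart of Z, so its coordinate
expressions are known maps with an exchanged base component. Stated for general splicings, it serves
both fibres F and F¹. -/
theorem GeneralSplicing.smoothBetween_replace_base {L L' L'' : LocalModel.{u}}
    {F F' : ScBanach.{u}} {R : GeneralSplicing L F} {R' : GeneralSplicing L' F'}
    (R'' : GeneralSplicing L'' F') {A : Set (L.space.lvl 0)} (hA : IsOpenIn A L.S.model.core)
    {g : L.space.lvl 0 × F.lvl 0 → L'.space.lvl 0 × F'.lvl 0}
    (hg : IsScSmoothBetween R.model R'.model {a | a ∈ R.model.core ∧ a.1 ∈ A} g)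
    {τ : L.space.lvl 0 → L''.space.lvl 0} (hτ : IsScSmoothBetween L.S.model L''.S.model A τ) :
    IsScSmoothBetween R.model R''.model {a | a ∈ R.model.core ∧ a.1 ∈ A}
      (fun a => (τ a.1, (g a).2)) :=
  IsScSmooth.prodMk
    (IsScSmoothBetween.comp L.S.isRegular hA hτ (R.smoothBetween_fst _) fun _ ha => ha.2)
    (IsScSmooth.snd hg)

/-- The base component of an sc_◁-smooth map may be replaced by any sc-smooth map. -/
theorem IsScStrongSmooth.replace_base {L L' L'' : LocalModel.{u}} {F F' : ScBanach.{u}}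
    {R : StrongSplicing L F} {R' : StrongSplicing L' F'} (R'' : StrongSplicing L'' F')
    {A : Set (L.space.lvl 0)} (hA : IsOpenIn A L.S.model.core)
    {g : L.space.lvl 0 × F.lvl 0 → L'.space.lvl 0 × F'.lvl 0} (hg : IsScStrongSmooth R R' A g)
    {τ : L.space.lvl 0 → L''.space.lvl 0} (hτ : IsScSmoothBetween L.S.model L''.S.model A τ) :
    IsScStrongSmooth R R'' A (fun a => (τ a.1, (g a).2)) := by
  obtain ⟨-, h0, g₁, h1, h1s⟩ := hg
  exact ⟨⟨τ, fun _ _ _ => rfl⟩, GeneralSplicing.smoothBetween_replace_base R''.zero hA h0 hτ,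
    fun a => (τ a.1, (g₁ a).2),
    fun a ha haA => by beta_reduce; rw [h1 a ha haA],
    GeneralSplicing.smoothBetween_replace_base R''.one hA h1s hτ⟩

namespace StrongBundleChart

section

variable {X : Type v} {Z : Type w} [TopologicalSpace X] [TopologicalSpace Z] {p : Z → X}
  {L L' : LocalModel.{u}} {F F' : ScBanach.{u}} {R : StrongSplicing L F} {R' : StrongSplicing L' F'}

/-- The part of sc_◁-smoothness with i = 0 is already smoothness of the transition between total
charts; hence a covering family of bundle charts generates the type-1 structure. -/
theorem TransitionSmooth.total {c : StrongBundleChart p R} {d : StrongBundleChart p R'}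
    (h : c.TransitionSmooth d) : c.total.TransitionSmooth d.total := by
  refine IsScSmoothBetween.mono h.2.1 fun a ha => ?_
  have hac := c.mem_total_target.1 ha.1
  refine ⟨hac, ?_, ?_⟩
  · rw [c.base_target]
    exact (R.zero.mem_core.1 hac).1
  · rw [← c.proj_symm hac]
    exact d.mem_total_source.1 ha.2

theorem Compatible.total {c : StrongBundleChart p R} {d : StrongBundleChart p R'}
    (h : c.Compatible d) : c.total.Compatible d.total := ⟨h.1.total, h.2.total⟩

end

/-! ### Pullback of strong bundle charts -/

variable {X Y Z : Type*} [TopologicalSpace X] [TopologicalSpace Y] [TopologicalSpace Z]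
  {p : Z → X} {f : Y → X} {L L' L₂ L₂' : LocalModel.{u}} {F F₂ : ScBanach.{u}}
  {R : StrongSplicing L F} {R' : StrongSplicing L' F}
  {R₂ : StrongSplicing L₂ F₂} {R₂' : StrongSplicing L₂' F₂}

/-- The chart `k` of `f^*Z` has the form `(y, z) ↦ (ψ(y), pr₂ Φ(z))` with the chart `Φ = c` of `Z`,
where `ψ` is the chart of `Y` that `k` covers. -/
def IsPullback (c : StrongBundleChart p R) (k : StrongBundleChart (pullbackProj f p) R') : Prop :=
  MapsTo f k.base.source c.base.source ∧ ∀ q : PullbackTotal f p, q.1.1 ∈ k.base.source →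
    k.total.toPartialEquiv q = (k.base.toPartialEquiv q.1.1, (c.total.toPartialEquiv q.1.2).2)

namespace IsPullback

variable {c : StrongBundleChart p R} {k : StrongBundleChart (pullbackProj f p) R'}
  {c₂ : StrongBundleChart p R₂} {k₂ : StrongBundleChart (pullbackProj f p) R₂'}

theorem proj_mem (h : c.IsPullback k) {q : PullbackTotal f p} (hq : q.1.1 ∈ k.base.source) :
    p q.1.2 ∈ c.base.source := by
  rw [q.2]
  exact h.1 hq

/-- The chart `c` covers its base chart and `k` copies the fibre component of `c`. So in coordinates
f' is θ on the base and the identity on the fibre. -/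
theorem apply_lift_symm (h : c.IsPullback k) {a : L'.space.lvl 0 × F.lvl 0}
    (ha : a ∈ R'.zero.model.core) :
    c.total.toPartialEquiv (k.total.toPartialEquiv.symm a).1.2 =
      (c.base.toPartialEquiv (f (k.base.toPartialEquiv.symm a.1)), a.2) := by
  have hq : (k.total.toPartialEquiv.symm a).1.1 ∈ k.base.source := k.proj_symm_mem ha
  refine Prod.ext ?_ ?_
  · rw [c.covers _ (c.mem_total_source.2 (h.proj_mem hq)), (k.total.toPartialEquiv.symm a).2,
      ← k.proj_symm ha]
    rfl
  · have := h.2 _ hq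
    rw [k.apply_symm ha] at this
    exact (congrArg Prod.snd this).symm

/-- The coordinate expression is the identity with its base component replaced by θ. -/
theorem isScStrongSmooth_lift (h : c.IsPullback k)
    (hθ : IsScSmoothBetween L'.S.model L.S.model k.base.target
      (fun b => c.base.toPartialEquiv (f (k.base.toPartialEquiv.symm b)))) :
    IsScStrongSmooth R' R k.base.target
      (fun a => c.total.toPartialEquiv (k.total.toPartialEquiv.symm a).1.2) :=
  ((IsScStrongSmooth.id R' R' _).replace_base R k.base.target_open hθ).congr
    fun _ ha _ => h.apply_lift_symm ha

/-- Lifting to Z, changing charts there and keeping the fibre component gives the right fibre part.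
The base component, still over X, is then exchanged for the transition of Y. -/
theorem transitionSmooth (h : c.IsPullback k) (h₂ : c₂.IsPullback k₂)
    (hθ : IsScSmoothBetween L'.S.model L.S.model k.base.target
      (fun b => c.base.toPartialEquiv (f (k.base.toPartialEquiv.symm b))))
    (hk : k.base.TransitionSmooth k₂.base) (hc : c.TransitionSmooth c₂) :
    k.TransitionSmooth k₂ := by
  have hA := k.base.isOpenIn_target_inter k₂.base.open_source
  have hmem : ∀ a ∈ R'.zero.model.core, a.1 ∈ {a | a ∈ k.base.target ∧
      k.base.toPartialEquiv.symm a ∈ k₂.base.source} →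
      (k.total.toPartialEquiv.symm a).1.1 ∈ k₂.base.source := fun a ha haA => by
    have : (k.total.toPartialEquiv.symm a).1.1 = k.base.toPartialEquiv.symm a.1 := k.proj_symm ha
    rw [this]
    exact haA.2
  have h1 := IsScStrongSmooth.comp (c.base.isOpenIn_target_inter c₂.base.open_source) hc
    ((h.isScStrongSmooth_lift hθ).mono (A' := {a | a ∈ k.base.target ∧
      k.base.toPartialEquiv.symm a ∈ k₂.base.source}) fun a ha => ha.1) fun a ha haA => by
    have hq := h.proj_mem (k.proj_symm_mem ha)
    refine ⟨c.apply_mem_core hq, ?_⟩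
    rw [c.covers _ (c.mem_total_source.2 hq)]
    refine ⟨c.base.map_source hq, ?_⟩
    rw [c.base.left_inv hq]
    exact h₂.proj_mem (hmem a ha haA)
  refine (h1.replace_base R₂' hA hk).congr fun a ha haA => ?_
  have hq := h.proj_mem (k.proj_symm_mem ha)
  rw [h₂.2 _ (hmem a ha haA)]
  refine Prod.ext ?_ ?_
  · show k₂.base.toPartialEquiv _ = k₂.base.toPartialEquiv _
    rw [← k.proj_symm ha]
    rfl
  · show _ = (c₂.total.toPartialEquiv (c.total.toPartialEquiv.symm (c.total.toPartialEquiv _))).2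
    rw [c.total.left_inv (c.mem_total_source.2 hq)]

end IsPullback

open Classical in
/-- The chart `(y, z) ↦ (ψ(y), pr₂ Φ(z))` of `f^*Z` for charts `ψ = d` of `Y` and `Φ = c` of `Z`. -/
noncomputable def pullback (hp : Function.Surjective p) (hf : Continuous f)
    (c : StrongBundleChart p R) {S : ScSplicing.{u}} (d : ScChart Y S.model)
    (hcd : MapsTo f d.source c.base.source) (R' : StrongSplicing d.localModel F)
    (hR' : ∀ a ∈ d.target, ∀ e, R'.zero.ρ a e =
      R.zero.ρ (c.base.toPartialEquiv (f (d.toPartialEquiv.symm a))) e) :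
    StrongBundleChart (pullbackProj f p) R' :=
  let θ : (S.model.space).lvl 0 → L.space.lvl 0 :=
    fun a => c.base.toPartialEquiv (f (d.toPartialEquiv.symm a))
  have hθ : ∀ a ∈ R'.zero.model.core, (θ a.1, a.2) ∈ R.zero.model.core := fun a ha => by
    obtain ⟨h1, h2⟩ := R'.zero.mem_core.1 ha
    refine R.zero.mem_core.2 ⟨?_, (hR' _ h1 _).symm.trans h2⟩
    rw [← c.base_target]
    exact c.base.map_source (hcd (d.map_target h1))
  have hpz : ∀ a ∈ R'.zero.model.core, p (c.total.toPartialEquiv.symm (θ a.1, a.2)) =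
      f (d.toPartialEquiv.symm a.1) := fun a ha => by
    rw [c.proj_symm (hθ a ha)]
    exact c.base.left_inv (hcd (d.map_target (R'.zero.mem_core.1 ha).1))
  -- The inverse must be defined everywhere, but the pair lies in f^*Z only for points of the core;
  -- elsewhere surjectivity of `p` supplies an arbitrary point over the same base point.
  let inv : (S.model.space).lvl 0 × F.lvl 0 → PullbackTotal f p := fun a =>
    if h : p (c.total.toPartialEquiv.symm (θ a.1, a.2)) = f (d.toPartialEquiv.symm a.1) then
      ⟨(d.toPartialEquiv.symm a.1, c.total.toPartialEquiv.symm (θ a.1, a.2)), h⟩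
    else ⟨(d.toPartialEquiv.symm a.1, (hp (f (d.toPartialEquiv.symm a.1))).choose),
      (hp (f (d.toPartialEquiv.symm a.1))).choose_spec⟩
  have hinv : ∀ a ∈ R'.zero.model.core, (inv a).1 =
      (d.toPartialEquiv.symm a.1, c.total.toPartialEquiv.symm (θ a.1, a.2)) := fun a ha => by
    simp only [inv, dif_pos (hpz a ha)]
  have hcov : ∀ q : PullbackTotal f p, q.1.1 ∈ d.source → c.total.toPartialEquiv q.1.2 =
      (θ (d.toPartialEquiv q.1.1), (c.total.toPartialEquiv q.1.2).2) := fun q hq => by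
    refine Prod.ext ?_ rfl
    have hz : p q.1.2 ∈ c.base.source := by rw [q.2]; exact hcd hq
    rw [c.covers _ (c.mem_total_source.2 hz), q.2]
    show _ = c.base.toPartialEquiv (f (d.toPartialEquiv.symm (d.toPartialEquiv q.1.1)))
    rw [d.left_inv hq]
  have hsrc : ∀ q : PullbackTotal f p, q.1.1 ∈ d.source → q.1.2 ∈ c.total.source := fun q hq =>
    c.mem_total_source.2 (by rw [q.2]; exact hcd hq)
  have hmap : ∀ q : PullbackTotal f p, q.1.1 ∈ d.source →
      (d.toPartialEquiv q.1.1, (c.total.toPartialEquiv q.1.2).2) ∈ R'.zero.model.core :=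
    fun q hq => by
    have h1 := c.mem_total_target.1 (c.total.map_source (hsrc q hq))
    rw [hcov q hq] at h1
    refine R'.zero.mem_core.2 ⟨d.map_source hq, ?_⟩
    exact (hR' _ (d.map_source hq) _).trans (R.zero.mem_core.1 h1).2
  { base := d
    base_target := rfl
    total :=
      { toFun := fun q => (d.toPartialEquiv q.1.1, (c.total.toPartialEquiv q.1.2).2)
        invFun := inv
        source := {q | q.1.1 ∈ d.source}
        target := R'.zero.model.core
        map_source' := hmap
        map_target' := fun a ha => by
          show (inv a).1.1 ∈ d.source
          rw [hinv a ha]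
          exact d.map_target (R'.zero.mem_core.1 ha).1
        left_inv' := fun q hq => by
          refine Subtype.ext ?_
          rw [hinv _ (hmap q hq)]
          refine Prod.ext (d.left_inv hq) ?_
          show c.total.toPartialEquiv.symm (θ (d.toPartialEquiv q.1.1), _) = q.1.2
          rw [← hcov q hq, c.total.left_inv (hsrc q hq)]
        right_inv' := fun a ha => by
          rw [hinv a ha]
          refine Prod.ext (d.right_inv (R'.zero.mem_core.1 ha).1) ?_
          show (c.total.toPartialEquiv (c.total.toPartialEquiv.symm (θ a.1, a.2))).2 = a.2
          rw [c.apply_symm (hθ a ha)]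
        open_source := d.open_source.preimage (continuous_fst.comp continuous_subtype_val)
        target_open := IsOpenIn.refl _
        continuousOn_toFun :=
          (d.continuousOn_toFun.comp (continuous_fst.comp continuous_subtype_val).continuousOn
            fun q hq => hq).prodMk
          (continuous_snd.comp_continuousOn (c.total.continuousOn_toFun.comp
            (continuous_snd.comp continuous_subtype_val).continuousOn fun q hq => hsrc q hq))
        continuousOn_invFun := by
          refine Topology.IsInducing.subtypeVal.continuousOn_iff.2 ?_
          have h1 : ContinuousOn (fun a : (S.model.space).lvl 0 × F.lvl 0 =>
              d.toPartialEquiv.symm a.1) R'.zero.model.core :=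
            d.continuousOn_invFun.comp continuous_fst.continuousOn
              fun a ha => (R'.zero.mem_core.1 ha).1
          have h2 : ContinuousOn (fun a : (S.model.space).lvl 0 × F.lvl 0 => (θ a.1, a.2))
              R'.zero.model.core :=
            (c.base.continuousOn_toFun.comp (hf.comp_continuousOn h1)
              fun a ha => hcd (d.map_target (R'.zero.mem_core.1 ha).1)).prodMk
              continuous_snd.continuousOn
          exact (h1.prodMk (c.total.continuousOn_invFun.comp h2
            fun a ha => c.mem_total_target.2 (hθ a ha))).congr hinv }
    total_source := rfl
    total_target := rfl
    covers := fun _ _ => rfl }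

end StrongBundleChart

/-! ### Strong bundles with common charts -/

section

variable {Y : Type v} {Z : Type w} [TopologicalSpace Y] [TopologicalSpace Z] {𝒴 : MPolyfold.{u} Y}
  {p : Z → Y}

/-- A strong bundle chart that is compatible with a covering family of charts in the atlas is in the
atlas. -/
theorem StrongBundle.mem_of_locally (𝒲 : StrongBundle 𝒴 p) {L : LocalModel.{u}} {F : ScBanach.{u}}
    {R : StrongSplicing L F} {c : StrongBundleChart p R} (hb : c.base ∈ 𝒴.atlas L.S)
    (hl : letI := 𝒲.fiberGroup; letI := 𝒲.fiberModule; c.FiberLinear)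
    (h : ∀ a ∈ c.base.source, ∃ (L' : LocalModel.{u}) (F' : ScBanach.{u})
      (R' : StrongSplicing L' F'), ∃ e ∈ 𝒲.atlas R', a ∈ e.base.source ∧ c.Compatible e) :
    c ∈ 𝒲.atlas R := by
  refine 𝒲.maximal R c hb ?_ hl fun R' d hd => ?_
  -- Compatibility of bundle charts implies that of total charts, so maximality of the type-1 atlas
  -- already contains `c.total`.
  · refine 𝒲.total.mem_of_locally TypeOneSplicing.isRegular fun z hz => ?_
    obtain ⟨L', F', R', e, he, hae, hce⟩ := h _ (c.mem_total_source.1 hz)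
    exact ⟨⟨L', F', R'.zero⟩, e.total, 𝒲.total_mem R' e he, e.mem_total_source.2 hae, hce.total⟩
  · refine StrongBundleChart.Compatible.of_locally fun a ha _ => ?_
    obtain ⟨L'', F'', R'', e, he, hae, hce⟩ := h _ ha
    exact ⟨L'', F'', R'', e, hae, hce, 𝒲.compatible R'' R' e he d hd⟩

/-- Two strong bundle structures are equal if they have the same linear structures on the fibres and
enough charts in common. -/
theorem StrongBundle.ext_of_cover {𝒲 𝒲' : StrongBundle 𝒴 p}
    (hadd : 𝒲.fiberGroup = 𝒲'.fiberGroup)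
    (hsmul : ∀ a (t : ℝ) (z : p ⁻¹' {a}),
      (letI := 𝒲.fiberGroup a; letI := 𝒲.fiberModule a; t • z) =
      (letI := 𝒲'.fiberGroup a; letI := 𝒲'.fiberModule a; t • z))
    (h : ∀ a, ∃ (L : LocalModel.{u}) (F : ScBanach.{u}) (R : StrongSplicing L F),
      ∃ c ∈ 𝒲.atlas R, c ∈ 𝒲'.atlas R ∧ a ∈ c.base.source) : 𝒲 = 𝒲' := by
  have htot : 𝒲.total = 𝒲'.total := ScAtlas.ext_of_cover TypeOneSplicing.isRegular fun z => by
    obtain ⟨L, F, R, c, hc, hc', ha⟩ := h (p z)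
    exact ⟨⟨L, F, R.zero⟩, c.total, 𝒲.total_mem R c hc, 𝒲'.total_mem R c hc',
      c.mem_total_source.2 ha⟩
  -- The bundles are quantified anew so that the inclusion can be used in both directions.
  have hsub : ∀ {𝒲 𝒲' : StrongBundle 𝒴 p} (hadd : 𝒲.fiberGroup = 𝒲'.fiberGroup)
      (hmod : HEq 𝒲.fiberModule 𝒲'.fiberModule)
      (h : ∀ a, ∃ (L : LocalModel.{u}) (F : ScBanach.{u}) (R : StrongSplicing L F),
        ∃ c ∈ 𝒲.atlas R, c ∈ 𝒲'.atlas R ∧ a ∈ c.base.source)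
      (L : LocalModel.{u}) (F : ScBanach.{u}) (R : StrongSplicing L F),
      𝒲.atlas R ⊆ 𝒲'.atlas R := by
    intro 𝒲 𝒲' hadd hmod h L F R c hc
    refine 𝒲'.mem_of_locally (𝒲.base_mem R c hc) ?_ fun a _ => ?_
    · have := 𝒲.linear R c hc
      revert this hadd hmod
      generalize 𝒲.fiberModule = m
      generalize 𝒲'.fiberModule = m'
      revert m m'
      generalize 𝒲.fiberGroup = g
      generalize 𝒲'.fiberGroup = g'
      rintro m m' rfl hm h
      cases hm
      exact h
    · obtain ⟨L', F', R', e, he, he', hae⟩ := h a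
      exact ⟨L', F', R', e, he', hae, 𝒲.compatible R R' c hc e he⟩
  -- The type of the module structures depends on the group structures; once these are identified,
  -- the scalar action determines the module.
  have hmod : HEq 𝒲.fiberModule 𝒲'.fiberModule := by
    revert hadd hsmul
    generalize 𝒲.fiberModule = m
    generalize 𝒲'.fiberModule = m'
    revert m m'
    generalize 𝒲.fiberGroup = g
    generalize 𝒲'.fiberGroup = g'
    rintro m m' rfl hsmul
    refine heq_of_eq (funext fun a => ?_)
    exact Module.ext' _ _ (hsmul a)
  have hat : @StrongBundle.atlas _ _ _ _ _ _ 𝒲 = @StrongBundle.atlas _ _ _ _ _ _ 𝒲' := by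
    funext L F R
    refine Subset.antisymm (hsub hadd hmod h L F R) (hsub hadd.symm hmod.symm (fun a => ?_) L F R)
    obtain ⟨L, F, R, c, hc, hc', ha⟩ := h a
    exact ⟨L, F, R, c, hc', hc, ha⟩
  cases 𝒲
  cases 𝒲'
  simp only at htot hadd hmod hat
  cases htot
  cases hadd
  cases hmod
  cases hat
  rfl

end

/-! ### The pullback bundle -/

section Pullback

variable {X Y Z : Type*} {f : Y → X} {p : Z → X}

/-- The fibre of `f^*Z` over `y` is the fibre of `Z` over `f(y)`. -/
def pullbackFiberHomeomorph [TopologicalSpace Y] [TopologicalSpace Z] (f : Y → X) (p : Z → X)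
    (y : Y) : (pullbackProj f p ⁻¹' {y}) ≃ₜ (p ⁻¹' {f y}) where
  toFun := pullbackFiberMap f p y
  invFun z := ⟨⟨(y, z.1), z.2⟩, rfl⟩
  left_inv q := by
    obtain ⟨⟨⟨y', z⟩, h⟩, rfl⟩ := q
    rfl
  right_inv _ := rfl
  continuous_toFun := Continuous.subtype_mk
    (continuous_snd.comp (continuous_subtype_val.comp continuous_subtype_val)) _
  continuous_invFun := Continuous.subtype_mk
    (Continuous.subtype_mk (continuous_const.prodMk continuous_subtype_val) _) _

variable [TopologicalSpace X] [TopologicalSpace Y] [TopologicalSpace Z]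
  {𝒳 : MPolyfold.{u} X} {𝒴 : MPolyfold.{u} Y}

/-- Fibrewise linearity of a strong bundle chart passes to its pullback. -/
theorem StrongBundleChart.IsPullback.fiberLinear {L L' : LocalModel.{u}} {F : ScBanach.{u}}
    {R : StrongSplicing L F} {R' : StrongSplicing L' F} {c : StrongBundleChart p R}
    {k : StrongBundleChart (pullbackProj f p) R'} (h : c.IsPullback k)
    [∀ a, AddCommGroup (p ⁻¹' {a})] [∀ a, Module ℝ (p ⁻¹' {a})]
    [∀ y, AddCommGroup (pullbackProj f p ⁻¹' {y})] [∀ y, Module ℝ (pullbackProj f p ⁻¹' {y})]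
    (hc : c.FiberLinear) (hlin : ∀ y, IsLinearMap ℝ (pullbackFiberMap f p y)) :
    k.FiberLinear := by
  intro y hy
  have key : ∀ q : pullbackProj f p ⁻¹' {y}, (k.total.toPartialEquiv q).2 =
      (c.total.toPartialEquiv (pullbackFiberMap f p y q)).2 := fun q => by
    have hq : q.1.1.1 ∈ k.base.source := by
      have : q.1.1.1 = y := q.2
      rwa [this]
    rw [h.2 q.1 hq]
    rfl
  refine ⟨fun q q' => ?_, fun t q => ?_⟩
  · rw [key, key, key, (hlin y).map_add, (hc _ (h.1 hy)).1]
  · rw [key, key, (hlin y).map_smul, (hc _ (h.1 hy)).2]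

/-- The pullbacks of the strong bundle charts of `Z` that cover charts of `Y`. -/
def StrongBundle.pullbackCharts (𝒵 : StrongBundle 𝒳 p) (𝒴 : MPolyfold.{u} Y) (f : Y → X)
    {L' : LocalModel.{u}} {F : ScBanach.{u}} (R' : StrongSplicing L' F) :
    Set (StrongBundleChart (pullbackProj f p) R') :=
  {k | k.base ∈ 𝒴.atlas L'.S ∧ ∃ (L : LocalModel.{u}) (R : StrongSplicing L F),
    ∃ c ∈ 𝒵.atlas R, c.IsPullback k}

variable {𝒵 : StrongBundle 𝒳 p}

theorem StrongBundle.compatible_pullbackCharts (hf : IsScSmoothMap 𝒴 𝒳 f)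
    {L' L₂' : LocalModel.{u}} {F F₂ : ScBanach.{u}} {R' : StrongSplicing L' F}
    {R₂' : StrongSplicing L₂' F₂} {k : StrongBundleChart (pullbackProj f p) R'}
    {k₂ : StrongBundleChart (pullbackProj f p) R₂'} (hk : k ∈ 𝒵.pullbackCharts 𝒴 f R')
    (hk₂ : k₂ ∈ 𝒵.pullbackCharts 𝒴 f R₂') : k.Compatible k₂ := by
  obtain ⟨hb, L, R, c, hc, h⟩ := hk
  obtain ⟨hb₂, L₂, R₂, c₂, hc₂, h₂⟩ := hk₂
  have hB := 𝒴.compatible _ _ hb _ _ hb₂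
  have hC := 𝒵.compatible R R₂ c hc c₂ hc₂
  exact ⟨h.transitionSmooth h₂ (hf.smoothBetween ScSplicing.isRegular ScSplicing.isRegular hb
      (𝒵.base_mem R c hc) h.1) hB.1 hC.1,
    h₂.transitionSmooth h (hf.smoothBetween ScSplicing.isRegular ScSplicing.isRegular hb₂
      (𝒵.base_mem R₂ c₂ hc₂) h₂.1) hB.2 hC.2⟩

/-- The expression of `f` is smooth in every admissible pair of charts of the maximal atlases, so it
can serve as base change for `R`. -/
theorem StrongBundle.exists_isPullback (hf : IsScSmoothMap 𝒴 𝒳 f) {L : LocalModel.{u}}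
    {F : ScBanach.{u}} {R : StrongSplicing L F} {c : StrongBundleChart p R} (hc : c ∈ 𝒵.atlas R)
    {S : ScSplicing.{u}} {d : ScChart Y S.model} (hd : d ∈ 𝒴.atlas S)
    (hcd : MapsTo f d.source c.base.source) :
    ∃ R' : StrongSplicing d.localModel F,
      (∀ a ∈ d.target, ∀ e, R'.zero.ρ a e =
        R.zero.ρ (c.base.toPartialEquiv (f (d.toPartialEquiv.symm a))) e) ∧
      ∃ k : StrongBundleChart (pullbackProj f p) R', k.base = d ∧ c.IsPullback k := by
  have hθ := hf.smoothBetween ScSplicing.isRegular ScSplicing.isRegular hd (𝒵.base_mem R c hc) hcd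
  refine ⟨R.pullback (L' := d.localModel) _ hθ fun a ha => ?_, fun _ _ _ => rfl,
    StrongBundleChart.pullback 𝒵.surjective hf.continuous c d hcd _ fun _ _ _ => rfl, rfl, hcd,
    fun _ _ => rfl⟩
  rw [← c.base_target]
  exact c.base.map_source (hcd (d.map_target ha))

/-- Continuity of `f` allows a chart of Y to be shrunk to the preimage of a trivialising open set of
X. -/
theorem StrongBundle.exists_charts (𝒵 : StrongBundle 𝒳 p) (hf : IsScSmoothMap 𝒴 𝒳 f) (y : Y) :
    ∃ (L : LocalModel.{u}) (F : ScBanach.{u}) (R : StrongSplicing L F), ∃ c ∈ 𝒵.atlas R,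
      ∃ (S : ScSplicing.{u}), ∃ d ∈ 𝒴.atlas S, MapsTo f d.source c.base.source ∧ y ∈ d.source := by
  obtain ⟨L, F, R, c, hc, hyc⟩ := 𝒵.cover (f y)
  obtain ⟨S, d, hd, hyd⟩ := 𝒴.cover y
  have hO := c.base.open_source.preimage hf.continuous
  exact ⟨L, F, R, c, hc, S, d.restrict hO, 𝒴.restrict_mem hd hO, fun a ha => ha.2, hyd, hyc⟩

theorem StrongBundle.exists_mem_pullbackCharts (𝒵 : StrongBundle 𝒳 p) (hf : IsScSmoothMap 𝒴 𝒳 f)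
    (y : Y) : ∃ (L' : LocalModel.{u}) (F : ScBanach.{u}) (R' : StrongSplicing L' F),
      ∃ k ∈ 𝒵.pullbackCharts 𝒴 f R', y ∈ k.base.source := by
  obtain ⟨L, F, R, c, hc, S, d, hd, hcd, hy⟩ := 𝒵.exists_charts hf y
  obtain ⟨R', -, k, hkd, hk⟩ := StrongBundle.exists_isPullback hf hc hd hcd
  rw [← hkd] at hd hy
  exact ⟨_, F, R', k, ⟨hd, L, R, c, hc, hk⟩, hy⟩

/-- The type-1 M-polyfold structure of `f^*Z`. -/
noncomputable def StrongBundle.pullbackTotal (𝒵 : StrongBundle 𝒳 p) (hf : IsScSmoothMap 𝒴 𝒳 f) :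
    MPolyfoldOne.{u} (PullbackTotal f p) :=
  ScAtlas.ofCharts TypeOneSplicing.isRegular
    (by have := 𝒴.t2; have := 𝒵.total.t2; infer_instance)
    (by
      have := 𝒴.secondCountable
      have := 𝒵.total.secondCountable
      exact Topology.IsInducing.subtypeVal.secondCountableTopology)
    -- The index `T` records only `R'.zero`, so strong splicings with different `one` may contribute
    -- to the same index; `HEq` compares the charts across the equation for `T`.
    (fun T => {t | ∃ (L' : LocalModel.{u}) (F : ScBanach.{u}) (R' : StrongSplicing L' F),
      ∃ k ∈ 𝒵.pullbackCharts 𝒴 f R', T = ⟨L', F, R'.zero⟩ ∧ HEq t k.total})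
    (fun q => by
      obtain ⟨L', F, R', k, hk, hq⟩ := 𝒵.exists_mem_pullbackCharts hf q.1.1
      exact ⟨_, k.total, ⟨L', F, R', k, hk, rfl, HEq.rfl⟩, k.mem_total_source.2 hq⟩)
    (by
      rintro _ t ⟨L', F, R', k, hk, rfl, ht⟩ _ t₂ ⟨L₂', F₂, R₂', k₂, hk₂, rfl, ht₂⟩
      cases ht
      cases ht₂
      exact (StrongBundle.compatible_pullbackCharts hf hk hk₂).total)

theorem StrongBundle.total_mem_pullbackTotal (hf : IsScSmoothMap 𝒴 𝒳 f) {L' : LocalModel.{u}}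
    {F : ScBanach.{u}} {R' : StrongSplicing L' F} {k : StrongBundleChart (pullbackProj f p) R'}
    (hk : k ∈ 𝒵.pullbackCharts 𝒴 f R') :
    k.total ∈ (𝒵.pullbackTotal hf).atlas ⟨L', F, R'.zero⟩ :=
  ScAtlas.mem_ofCharts _ _ _ _ _ _ ⟨L', F, R', k, hk, rfl, HEq.rfl⟩

/-- The pullback of a strong bundle. -/
noncomputable def StrongBundle.pullback (𝒵 : StrongBundle 𝒳 p) (hf : IsScSmoothMap 𝒴 𝒳 f) :
    StrongBundle 𝒴 (pullbackProj f p) :=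
  letI : ∀ a, AddCommGroup (p ⁻¹' {a}) := 𝒵.fiberGroup
  letI : ∀ a, Module ℝ (p ⁻¹' {a}) := 𝒵.fiberModule
  -- Transport along the fibre homeomorphism makes f' linear on fibres by construction.
  letI : ∀ y, AddCommGroup (pullbackProj f p ⁻¹' {y}) := fun y =>
    (pullbackFiberHomeomorph f p y).toEquiv.addCommGroup
  letI : ∀ y, Module ℝ (pullbackProj f p ⁻¹' {y}) := fun y =>
    (pullbackFiberHomeomorph f p y).toEquiv.module ℝ
  have hlin : ∀ y, IsLinearMap ℝ (pullbackFiberMap f p y) := fun y =>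
    ((pullbackFiberHomeomorph f p y).toEquiv.linearEquiv ℝ).toLinearMap.isLinear
  { total := 𝒵.pullbackTotal hf
    surjective := fun y => by
      obtain ⟨z, hz⟩ := 𝒵.surjective (f y)
      exact ⟨⟨(y, z), hz⟩, rfl⟩
    smooth := fun q => by
      obtain ⟨L', F, R', k, hk, hq⟩ := 𝒵.exists_mem_pullbackCharts hf q.1.1
      refine ⟨⟨L', F, R'.zero⟩, k.total, StrongBundle.total_mem_pullbackTotal hf hk, L'.S, k.base,
        hk.1, k.mem_total_source.2 hq, fun q hq => k.mem_total_source.1 hq,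
        (R'.zero.smoothBetween_fst k.total.target).congr fun b hb => ?_⟩
      have hb' := k.mem_total_target.1 hb
      show k.base.toPartialEquiv _ = b.1
      rw [← k.covers _ (k.symm_mem hb'), k.apply_symm hb']
    fiberBanach := fun y => by
      obtain ⟨B, _, _, _, ⟨e⟩⟩ := 𝒵.fiberBanach (f y)
      let e₁ : (pullbackProj f p ⁻¹' {y}) ≃L[ℝ] (p ⁻¹' {f y}) :=
        { (pullbackFiberHomeomorph f p y).toEquiv.linearEquiv ℝ with
          continuous_toFun := (pullbackFiberHomeomorph f p y).continuous
          continuous_invFun := (pullbackFiberHomeomorph f p y).symm.continuous }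
      -- The Banach model of a fibre must lie in the universe of f^*Z, which also involves that of
      -- Y.
      exact ⟨ULift B, inferInstance, inferInstance, inferInstance,
        ⟨(e₁.trans e).trans ContinuousLinearEquiv.ulift.symm⟩⟩
    -- Compatibility is tested only against the generating pullback charts; these belong to the
    -- atlas, which yields maximality.
    atlas := fun {L F} R => {k | k.base ∈ 𝒴.atlas L.S ∧
      k.total ∈ (𝒵.pullbackTotal hf).atlas ⟨L, F, R.zero⟩ ∧ k.FiberLinear ∧
      ∀ {L' : LocalModel.{u}} {F' : ScBanach.{u}} (R' : StrongSplicing L' F'),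
        ∀ d ∈ 𝒵.pullbackCharts 𝒴 f R', k.Compatible d}
    base_mem := fun _ _ hk => hk.1
    total_mem := fun _ _ hk => hk.2.1
    linear := fun _ _ hk => hk.2.2.1
    cover := fun y => by
      obtain ⟨L', F, R', k, hk, hy⟩ := 𝒵.exists_mem_pullbackCharts hf y
      obtain ⟨L, R, c, hc, h⟩ := hk.2
      exact ⟨L', F, R', k, ⟨hk.1, StrongBundle.total_mem_pullbackTotal hf hk,
        h.fiberLinear (𝒵.linear R c hc) hlin,
        fun _ _ hd => StrongBundle.compatible_pullbackCharts hf hk hd⟩, hy⟩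
    compatible := fun _ _ _ hk _ hk₂ => StrongBundleChart.Compatible.of_locally fun y _ _ => by
      obtain ⟨L', F, R', e, he, hy⟩ := 𝒵.exists_mem_pullbackCharts hf y
      exact ⟨L', F, R', e, hy, hk.2.2.2 R' e he, (hk₂.2.2.2 R' e he).symm⟩
    maximal := fun _ _ hb ht hl hk => ⟨hb, ht, hl, fun R' d hd => by
      obtain ⟨L, R, c, hc, h⟩ := hd.2
      exact hk R' d ⟨hd.1, StrongBundle.total_mem_pullbackTotal hf hd,
        h.fiberLinear (𝒵.linear R c hc) hlin,
        fun _ _ hd₂ => StrongBundle.compatible_pullbackCharts hf hd hd₂⟩⟩ }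

theorem StrongBundle.isLinearMap_pullback (hf : IsScSmoothMap 𝒴 𝒳 f) (y : Y) :
    letI := (𝒵.pullback hf).fiberGroup y
    letI := (𝒵.pullback hf).fiberModule y
    letI := 𝒵.fiberGroup (f y)
    letI := 𝒵.fiberModule (f y)
    IsLinearMap ℝ (pullbackFiberMap f p y) :=
  let _ := 𝒵.fiberGroup (f y)
  let _ := 𝒵.fiberModule (f y)
  let _ := (pullbackFiberHomeomorph f p y).toEquiv.addCommGroup
  let _ := (pullbackFiberHomeomorph f p y).toEquiv.module ℝ
  ((pullbackFiberHomeomorph f p y).toEquiv.linearEquiv ℝ).toLinearMap.isLinear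

/-- If `f'` is linear on the fibres, and enough pullback charts are in the atlas, then all of them
are. -/
theorem StrongBundle.pullbackCharts_subset_atlas (hf : IsScSmoothMap 𝒴 𝒳 f)
    {𝒲 : StrongBundle 𝒴 (pullbackProj f p)}
    (hlin : ∀ y,
      letI := 𝒲.fiberGroup y
      letI := 𝒲.fiberModule y
      letI := 𝒵.fiberGroup (f y)
      letI := 𝒵.fiberModule (f y)
      IsLinearMap ℝ (pullbackFiberMap f p y))
    (hcov : ∀ y, ∃ (L' : LocalModel.{u}) (F : ScBanach.{u}) (R' : StrongSplicing L' F),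
      ∃ k ∈ 𝒲.atlas R', k ∈ 𝒵.pullbackCharts 𝒴 f R' ∧ y ∈ k.base.source)
    {L' : LocalModel.{u}} {F : ScBanach.{u}} (R' : StrongSplicing L' F) :
    𝒵.pullbackCharts 𝒴 f R' ⊆ 𝒲.atlas R' := by
  intro k hk
  refine 𝒲.mem_of_locally hk.1 ?_ fun y _ => ?_
  · obtain ⟨L, R, c, hc, h⟩ := hk.2
    let _ := 𝒲.fiberGroup
    let _ := 𝒲.fiberModule
    let _ := 𝒵.fiberGroup
    let _ := 𝒵.fiberModule
    exact h.fiberLinear (𝒵.linear R c hc) hlin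
  · obtain ⟨L₂, F₂, R₂, e, he, he', hy⟩ := hcov y
    exact ⟨L₂, F₂, R₂, e, he, hy, StrongBundle.compatible_pullbackCharts hf hk he'⟩

theorem StrongBundle.pullbackCharts_subset_pullback (hf : IsScSmoothMap 𝒴 𝒳 f)
    {L' : LocalModel.{u}} {F : ScBanach.{u}} (R' : StrongSplicing L' F) :
    𝒵.pullbackCharts 𝒴 f R' ⊆ (𝒵.pullback hf).atlas R' := by
  intro k hk
  obtain ⟨L, R, c, hc, h⟩ := hk.2
  let _ := (𝒵.pullback hf).fiberGroup
  let _ := (𝒵.pullback hf).fiberModule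
  let _ := 𝒵.fiberGroup
  let _ := 𝒵.fiberModule
  exact ⟨hk.1, StrongBundle.total_mem_pullbackTotal hf hk,
    h.fiberLinear (𝒵.linear R c hc) (StrongBundle.isLinearMap_pullback hf),
    fun _ _ hd => StrongBundle.compatible_pullbackCharts hf hk hd⟩

theorem StrongBundle.isInducedBundle_pullback (𝒵 : StrongBundle 𝒳 p) (hf : IsScSmoothMap 𝒴 𝒳 f) :
    IsInducedBundle 𝒵 f (𝒵.pullback hf) := by
  refine ⟨StrongBundle.isLinearMap_pullback hf, fun {L F} R c hc S d hd hcd => ?_⟩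
  obtain ⟨R', hR', k, hkd, hk⟩ := StrongBundle.exists_isPullback hf hc hd hcd
  have hk2 := hk.2
  rw [← hkd] at hd
  rw [hkd] at hk2
  exact ⟨R', hR', k, StrongBundle.pullbackCharts_subset_pullback hf R' ⟨hd, L, R, c, hc, hk⟩, hkd,
    hk2⟩

/-- The definition yields a chart for some strong splicing with the prescribed `zero.ρ` over the
target, so two induced structures need not visibly share a splicing. The charts it yields still
cover, and maximality then forces all pullback charts, for every admissible `R'`, into the atlas. -/
theorem IsInducedBundle.pullbackCharts_subset_atlas (hf : IsScSmoothMap 𝒴 𝒳 f)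
    {𝒲 : StrongBundle 𝒴 (pullbackProj f p)} (h : IsInducedBundle 𝒵 f 𝒲)
    {L' : LocalModel.{u}} {F : ScBanach.{u}} (R' : StrongSplicing L' F) :
    𝒵.pullbackCharts 𝒴 f R' ⊆ 𝒲.atlas R' := by
  refine StrongBundle.pullbackCharts_subset_atlas hf h.1 (fun y => ?_) R'
  obtain ⟨L, F, R, c, hc, S, d, hd, hcd, hy⟩ := 𝒵.exists_charts hf y
  obtain ⟨R', -, k, hk, hkd, hkt⟩ := h.2 R c hc S d hd hcd
  have hp : c.IsPullback k := by
    refine ⟨by rw [hkd]; exact hcd, fun q hq => ?_⟩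
    rw [hkd] at hq ⊢
    exact hkt q hq
  rw [← hkd] at hd hy
  exact ⟨_, F, R', k, hk, ⟨hd, L, R, c, hc, hp⟩, hy⟩

theorem IsInducedBundle.map_add {𝒲 : StrongBundle 𝒴 (pullbackProj f p)}
    (h : IsInducedBundle 𝒵 f 𝒲) (y : Y) (q q' : pullbackProj f p ⁻¹' {y}) :
    letI := 𝒲.fiberGroup y
    letI := 𝒵.fiberGroup (f y)
    pullbackFiberMap f p y (q + q') = pullbackFiberMap f p y q + pullbackFiberMap f p y q' :=
  let _ := 𝒲.fiberGroup y
  let _ := 𝒲.fiberModule y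
  let _ := 𝒵.fiberGroup (f y)
  let _ := 𝒵.fiberModule (f y)
  (h.1 y).map_add q q'

theorem IsInducedBundle.map_smul {𝒲 : StrongBundle 𝒴 (pullbackProj f p)}
    (h : IsInducedBundle 𝒵 f 𝒲) (y : Y) (t : ℝ) (q : pullbackProj f p ⁻¹' {y}) :
    letI := 𝒲.fiberGroup y
    letI := 𝒲.fiberModule y
    letI := 𝒵.fiberGroup (f y)
    letI := 𝒵.fiberModule (f y)
    pullbackFiberMap f p y (t • q) = t • pullbackFiberMap f p y q :=
  let _ := 𝒲.fiberGroup y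
  let _ := 𝒲.fiberModule y
  let _ := 𝒵.fiberGroup (f y)
  let _ := 𝒵.fiberModule (f y)
  (h.1 y).map_smul t q

/-- The induced strong bundle structure on the pullback is unique. -/
theorem IsInducedBundle.unique (hf : IsScSmoothMap 𝒴 𝒳 f)
    {𝒲 𝒲' : StrongBundle 𝒴 (pullbackProj f p)} (h : IsInducedBundle 𝒵 f 𝒲)
    (h' : IsInducedBundle 𝒵 f 𝒲') : 𝒲 = 𝒲' := by
  refine StrongBundle.ext_of_cover ?_ (fun y t q => ?_) fun y => ?_
  -- Since f' is injective on each fibre, its additivity determines the sum, and the sum determines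
  -- the group structure.
  · funext y
    refine AddCommGroup.ext ?_
    funext q q'
    exact (pullbackFiberHomeomorph f p y).injective
      ((h.map_add y q q').trans (h'.map_add y q q').symm)
  · exact (pullbackFiberHomeomorph f p y).injective
      ((h.map_smul y t q).trans (h'.map_smul y t q).symm)
  · obtain ⟨L', F, R', k, hk, hy⟩ := 𝒵.exists_mem_pullbackCharts hf y
    exact ⟨L', F, R', k, h.pullbackCharts_subset_atlas hf R' hk,
      h'.pullbackCharts_subset_atlas hf R' hk, hy⟩

theorem StrongBundle.isStrongBundleMap_pullbackLift (𝒵 : StrongBundle 𝒳 p)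
    (hf : IsScSmoothMap 𝒴 𝒳 f) :
    IsStrongBundleMap (𝒵.pullback hf) 𝒵 (pullbackLift f p) f := by
  refine ⟨fun q => q.2, fun y => ?_⟩
  obtain ⟨L', F, R', k, hk, hy⟩ := 𝒵.exists_mem_pullbackCharts hf y
  have hk' := StrongBundle.pullbackCharts_subset_pullback hf R' hk
  obtain ⟨hb, L, R, c, hc, h⟩ := hk
  exact ⟨L', F, R', L, F, R, k, hk', c, hc, hy, h.1, h.isScStrongSmooth_lift
    (hf.smoothBetween ScSplicing.isRegular ScSplicing.isRegular hb (𝒵.base_mem R c hc) h.1)⟩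

end Pullback

theorem mainTheorem7 {X : Type*} {Y : Type*} {Z : Type*}
    [TopologicalSpace X] [TopologicalSpace Y] [TopologicalSpace Z]
    (𝒳 : MPolyfold.{u} X) (𝒴 : MPolyfold.{u} Y) (p : Z → X) (𝒵 : StrongBundle 𝒳 p)
    (f : Y → X) (hf : IsScSmoothMap 𝒴 𝒳 f) :
    ∃ 𝒲 : StrongBundle 𝒴 (pullbackProj f p),
      IsInducedBundle 𝒵 f 𝒲 ∧
      IsStrongBundleMap 𝒲 𝒵 (pullbackLift f p) f ∧
      ∀ 𝒲' : StrongBundle 𝒴 (pullbackProj f p), IsInducedBundle 𝒵 f 𝒲' → 𝒲' = 𝒲 :=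
  ⟨𝒵.pullback hf, 𝒵.isInducedBundle_pullback hf, 𝒵.isStrongBundleMap_pullbackLift hf,
    fun _ h => h.unique hf (𝒵.isInducedBundle_pullback hf)⟩
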